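/- Let $G$ be a simply-connected three-dimensional Lie group whose Lie algebra $\mathfrak g$ is nonabelian and unimodular (i.e. $\operatorname{tr}\operatorname{ad}_X=0$ for all $X\in\mathfrak g$), and let $g_0$ be a left-invariant Riemannian metric on $G$. For a left-invariant metric $g$ on $G$ let $(\mathfrak g,\mathsf Q)$ be the metric Lie algebra with $\mathsf Q=g|_{T_eG}$. 1. The Ricci flow $\partial g/\partial t=-2\operatorname{Rc}(g)$ on $G$ with $g(0)=g_0$ is a flow of metric Lie algebras $(\mathfrak g,\mathsf Q_t)$: there are $\varepsilon>0$ and a solution $g(t)$, $t\in(-\varepsilon,\varepsilon)$, with $g(0)=g_0$, consisting of left-invariant metrics, and on every interval $J\ni 0$ there is at most one solution by left-invariant metrics with $g(0)=g_0$. 2. There is a $\mathsf Q_0$-orthonormal basis $f_1,f_2,f_3$ of $\mathfrak g$ such that $$[f_2,f_3]=\lambda_1f_1,\qquad [f_3,f_1]=\lambda_2f_2,\qquad [f_1,f_2]=\lambda_3f_3$$ for some $\lambda_1,\lambda_2,\lambda_3\in\mathbb R$. 3. Let $f_1,f_2,f_3$ be any such basis, and let $g(t)$, $t\in J$, be a Ricci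 flow of left-invariant metrics with $g(0)=g_0$ on an interval $J\ni 0$. Put $e_i(t)=f_i/\sqrt{\mathsf Q_t(f_i,f_i)}$. Then for every $t\in J$ the basis $e_1(t),e_2(t),e_3(t)$ is $\mathsf Q_t$-orthonormal and $$[e_2,e_3]=a_1e_1,\qquad [e_3,e_1]=a_2e_2,\qquad [e_1,e_2]=a_3e_3$$ for functions $a_i=a_i(t)$ which evolve by the autonomous system $$\frac{da_i}{dt}=\frac{a_i}{2}\left((a_j-a_k)^2-3a_i^2+2a_i(a_j+a_k)\right),\qquad \{i,j,k\}=\{1,2,3\}.$$ 4. If moreover $\lambda_1\neq0$, then $a_1(t)\ne0$ for all $t\in J$, and $m_2=a_2/a_1$ and $m_3=a_3/a_1$ satisfy on $J$ $$\frac{dm_2}{dt}=2a_1^2\,m_2(1-m_2)(1+m_2-m_3),\qquad \frac{dm_3}{dt}=2a_1^2\,m_3(1-m_3)(1-m_2+m_3).$$ (At an endpoint of $J$ that belongs to $J$ derivatives are one-sided.) -/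

import Mathlib

open Set
open scoped Manifold ContDiff

set_option maxSynthPendingDepth 3

noncomputable section

/-! ### The Levi-Civita connection and the Ricci tensor in coordinates

In this section `b` is a field of bilinear forms on a finite-dimensional vector space `E`, thought of
as the coordinate expression of a Riemannian metric in a chart. -/

namespace CoordMetric

variable {E : Type*} [NormedAddCommGroup E] [NormedSpace ℝ E]

/-- The Christoffel symbols of the first kind as a trilinear map,
`(v, w, z) ↦ (∂_v b(w, z) + ∂_w b(v, z) - ∂_z b(v, w)) / 2`. -/
def christoffelLower (b : E → E →L[ℝ] E →L[ℝ] ℝ) (y : E) : E →L[ℝ] E →L[ℝ] E →L[ℝ] ℝ :=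
  let D : E →L[ℝ] E →L[ℝ] E →L[ℝ] ℝ := fderiv ℝ b y
  let flip : (E →L[ℝ] E →L[ℝ] ℝ) →L[ℝ] E →L[ℝ] E →L[ℝ] ℝ :=
    (ContinuousLinearMap.flipₗᵢ ℝ E E ℝ).toContinuousLinearEquiv
  (1 / 2 : ℝ) • (D + D.flip - flip.comp D.flip)

theorem christoffelLower_apply (b : E → E →L[ℝ] E →L[ℝ] ℝ) (y v w z : E) :
    christoffelLower b y v w z =
      (1 / 2 : ℝ) * (fderiv ℝ b y v w z + fderiv ℝ b y w v z - fderiv ℝ b y z v w) := by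
  simp [christoffelLower]

/-- The Christoffel symbols of the second kind: `christoffel b y v w` is the vector `Γ(v, w)` with
`b y (Γ(v, w)) z = christoffelLower b y v w z` for all `z`. In the chart, the Levi-Civita
connection is `∇_V W = ∂_V W + Γ(V, W)`. -/
def christoffel (b : E → E →L[ℝ] E →L[ℝ] ℝ) (y : E) : E →L[ℝ] E →L[ℝ] E :=
  (ContinuousLinearMap.compL ℝ E (E →L[ℝ] ℝ) E (b y).inverse).comp (christoffelLower b y)

theorem christoffel_apply (b : E → E →L[ℝ] E →L[ℝ] ℝ) (y v w : E) :
    christoffel b y v w = (b y).inverse (christoffelLower b y v w) := rfl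

/-- The curvature operator `u ↦ R(u, v) w`, with the sign convention
`R(u, v) w = ∇_u ∇_v w - ∇_v ∇_u w - ∇_[u, v] w`, evaluated on coordinate vector fields. -/
def curvature (b : E → E →L[ℝ] E →L[ℝ] ℝ) (y v w : E) : E →ₗ[ℝ] E where
  toFun u := fderiv ℝ (christoffel b) y u v w - fderiv ℝ (christoffel b) y v u w
    + christoffel b y u (christoffel b y v w) - christoffel b y v (christoffel b y u w)
  map_add' u u' := by
    simp only [map_add, add_apply]
    abel
  map_smul' c u := by
    simp only [map_smul, smul_apply, smul_add, smul_sub, RingHom.id_apply]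

/-- The Ricci tensor `Rc(v, w) = tr (u ↦ R(u, v) w)`. -/
def ricci (b : E → E →L[ℝ] E →L[ℝ] ℝ) (y v w : E) : ℝ :=
  LinearMap.trace ℝ E (curvature b y v w)

end CoordMetric

/-! ### Riemannian metrics and Ricci flow on manifolds -/

section Manifold

variable {E : Type*} [NormedAddCommGroup E] [NormedSpace ℝ E]
  {M : Type*} [TopologicalSpace M] [ChartedSpace E M] [IsManifold 𝓘(ℝ, E) ∞ M]

variable (E M) in
/-- Smooth Riemannian metrics on the smooth manifold `M` modelled on `E`. -/
abbrev SmoothMetric : Type _ :=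
  Bundle.ContMDiffRiemannianMetric 𝓘(ℝ, E) ∞ E (fun x : M ↦ TangentSpace 𝓘(ℝ, E) x)

/-- The expression of the metric `g` in the preferred chart `φ` at `x`: the pullback of `g` by the
inverse of `φ`. -/
def SmoothMetric.inChart (g : SmoothMetric E M) (x : M) (y : E) : E →L[ℝ] E →L[ℝ] ℝ :=
  let B : E →L[ℝ] E →L[ℝ] ℝ := g.inner ((extChartAt 𝓘(ℝ, E) x).symm y)
  let D : E →L[ℝ] E := mfderiv 𝓘(ℝ, E) 𝓘(ℝ, E) (extChartAt 𝓘(ℝ, E) x).symm y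
  B.bilinearComp D D

theorem SmoothMetric.inChart_apply (g : SmoothMetric E M) (x : M) (y v w : E) :
    g.inChart x y v w = g.inner ((extChartAt 𝓘(ℝ, E) x).symm y)
      (mfderiv 𝓘(ℝ, E) 𝓘(ℝ, E) (extChartAt 𝓘(ℝ, E) x).symm y v)
      (mfderiv 𝓘(ℝ, E) 𝓘(ℝ, E) (extChartAt 𝓘(ℝ, E) x).symm y w) := rfl

/-- The Ricci tensor of `g` at `x`, computed in the preferred chart at `x`. (The tangent space at
`x` is by definition the model space `E`, a vector being identified with its coordinates in
the preferred chart at `x`.) -/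
def SmoothMetric.ricci (g : SmoothMetric E M) (x : M) (v w : TangentSpace 𝓘(ℝ, E) x) : ℝ :=
  CoordMetric.ricci (g.inChart x) (extChartAt 𝓘(ℝ, E) x x) v w

/-- The family `g t`, `t ∈ J`, of Riemannian metrics solves the Ricci flow equation
`∂g/∂t = -2 Rc(g)` (with one-sided derivatives at the endpoints of `J` that belong to `J`). -/
def IsRicciFlowOn (g : ℝ → SmoothMetric E M) (J : Set ℝ) : Prop :=
  ∀ t ∈ J, ∀ (x : M) (v w : TangentSpace 𝓘(ℝ, E) x),
    HasDerivWithinAt (fun s ↦ (g s).inner x v w) (-2 * (g t).ricci x v w) J t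

end Manifold

/-! ### Left-invariant metrics and metric Lie algebras -/

instance : ENat.LEInfty (minSmoothness ℝ 3) :=
  ⟨by rw [minSmoothness_of_isRCLikeNormedField]; exact ENat.LEInfty.out⟩

section LieGroup

variable {E : Type*} [NormedAddCommGroup E] [NormedSpace ℝ E]
  {G : Type*} [TopologicalSpace G] [ChartedSpace E G] [Group G] [LieGroup 𝓘(ℝ, E) ∞ G]

/-- The metric `g` on the Lie group `G` is left-invariant: all left translations are isometries. -/
def SmoothMetric.IsLeftInvariant (g : SmoothMetric E G) : Prop :=
  ∀ (p x : G) (v w : TangentSpace 𝓘(ℝ, E) x),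
    g.inner (p * x) (mfderiv 𝓘(ℝ, E) 𝓘(ℝ, E) (fun y ↦ p * y) x v)
      (mfderiv 𝓘(ℝ, E) 𝓘(ℝ, E) (fun y ↦ p * y) x w) = g.inner x v w

/-- `g t`, `t ∈ J`, is a Ricci flow of left-invariant metrics on `G` with `g 0 = g₀`. -/
structure IsLeftInvariantRicciFlow (g₀ : SmoothMetric E G) (g : ℝ → SmoothMetric E G)
    (J : Set ℝ) : Prop where
  ricciFlow : IsRicciFlowOn g J
  leftInvariant : ∀ t ∈ J, (g t).IsLeftInvariant
  initial : g 0 = g₀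

/-- The metric Lie algebra of `(G, g)`: the inner product on the Lie algebra of `G` obtained by
restricting `g` to the tangent space at the identity. -/
def SmoothMetric.lieInner (g : SmoothMetric E G) (v w : GroupLieAlgebra 𝓘(ℝ, E) G) : ℝ :=
  g.inner 1 v w

end LieGroup

/-- A Lie algebra is unimodular if `ad X` is trace free for all `X`. -/
def LieIsUnimodular (L : Type*) [LieRing L] [LieAlgebra ℝ L] : Prop :=
  ∀ X : L, LinearMap.trace ℝ L (LieAlgebra.ad ℝ L X) = 0

/-- `e 0, e 1, e 2` is a `Q`-orthonormal frame in which the Lie bracket is diagonal with structure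
constants `a 0, a 1, a 2`. -/
structure IsMilnorFrame {L : Type*} [LieRing L] [LieAlgebra ℝ L] (Q : L → L → ℝ)
    (e : Fin 3 → L) (a : Fin 3 → ℝ) : Prop where
  orthonormal : ∀ i j, Q (e i) (e j) = if i = j then 1 else 0
  bracket_one_two : ⁅e 1, e 2⁆ = a 0 • e 0
  bracket_two_zero : ⁅e 2, e 0⁆ = a 1 • e 1
  bracket_zero_one : ⁅e 0, e 1⁆ = a 2 • e 2

end

/-! In a left-invariant frame both the metric coefficients and the structure constants are constant,
so the Koszul formula makes the connection, the curvature and hence the Ricci tensor algebraic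
expressions in the structure constants `c` and the Gram matrix `q` (`ricci_frame`, transported to
the group through the preferred chart in `ricci_mulInvariantVectorField`). Ricci flow of
left-invariant metrics thus becomes the autonomous equation `q' = -2 * frameRicci c q`, which is
smooth where `q` is nondegenerate; this gives uniqueness (`IsLeftInvariantRicciFlow.eqOn`).

In dimension three an inner product turns the bracket into `[v, w] = A (v × w)` for a linear map
`A`, and the traces of `ad` measure the skew part of `A`. Unimodularity therefore makes `A`
symmetric, and an orthonormal eigenbasis of `A` diagonalizes the bracket (`exists_isMilnorFrame`).

Reversing two vectors of such a frame is a Lie algebra automorphism that fixes the initial metric.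
The Ricci tensor is equivariant under it (`frameRicci_conj`), so by uniqueness it fixes the whole
flow, and the off-diagonal entries of `q` vanish (`lieInner_eq_zero`). What remains is a system for
three squared lengths, explicit by `frameRicci_milnor`. Picard–Lindelöf solves it, and its solution
defines left-invariant metrics that form the flow. Rescaling to unit length turns the constants `l
i` into `l i * √(q i) / (√(q j) * √(q k))`; differentiating these and their ratios yields the stated
equations. -/

noncomputable section

open Filter Topology Matrix

/-! ### Curvature of a metric with constant coefficients in a frame -/

section FrameCurvature

variable {ι : Type*} [Fintype ι] [DecidableEq ι]

/-- The Levi-Civita connection `∇_{X i} X j = ∑ k, frameConn c q i j k • X k` in a frame with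
`[X i, X j] = ∑ k, c i j k • X k` in which the metric has the constant coefficients `q`. -/
def frameConn (c : ι → ι → ι → ℝ) (q : Matrix ι ι ℝ) (i j k : ι) : ℝ :=
  ∑ m, (1 / 2 : ℝ) * (∑ l, (c i j l * q l m - c j m l * q l i + c m i l * q l j)) * q⁻¹ m k

/-- The curvature tensor `R(X i, X j) X k = ∑ m, frameCurvature c q i j k m • X m` in a frame as in
`frameConn`. -/
def frameCurvature (c : ι → ι → ι → ℝ) (q : Matrix ι ι ℝ) (i j k m : ι) : ℝ :=
  ∑ l, (frameConn c q j k l * frameConn c q i l m - frameConn c q i k l * frameConn c q j l m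
    - c i j l * frameConn c q l k m)

/-- The Ricci tensor in a frame as in `frameConn`. -/
def frameRicci (c : ι → ι → ι → ℝ) (q : Matrix ι ι ℝ) (j k : ι) : ℝ :=
  ∑ i, frameCurvature c q i j k i

variable {c : ι → ι → ι → ℝ} {q : Matrix ι ι ℝ}

/-- `frameConn` raises the last index of the Koszul expression with `q⁻¹`; multiplying by `q` lowers
it again. -/
theorem sum_frameConn_mul (hq : IsUnit q.det) (i j m : ι) :
    ∑ k, frameConn c q i j k * q k m =
      (1 / 2 : ℝ) * ∑ l, (c i j l * q l m - c j m l * q l i + c m i l * q l j) := by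
  set u : ι → ℝ := fun m ↦
    (1 / 2 : ℝ) * ∑ l, (c i j l * q l m - c j m l * q l i + c m i l * q l j) with hu
  have h1 : (fun k ↦ frameConn c q i j k) = u ᵥ* q⁻¹ := by
    ext k
    simp [frameConn, vecMul, dotProduct, hu]
  have h2 : (u ᵥ* q⁻¹) ᵥ* q = u := by
    rw [vecMul_vecMul, nonsing_inv_mul _ hq, vecMul_one]
  have := congrFun h2 m
  rw [← h1] at this
  simpa [vecMul, dotProduct, hu] using this

variable {E : Type*} [NormedAddCommGroup E] [NormedSpace ℝ E] [FiniteDimensional ℝ E]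

/-- A basis of the finite-dimensional space `E` identifies operators `E →L[ℝ] F` with tuples of
vectors of `F`, so smoothness can be tested on vectors. -/
theorem contDiffAt_clm_of_apply {D F : Type*} [NormedAddCommGroup D] [NormedSpace ℝ D]
    [NormedAddCommGroup F] [NormedSpace ℝ F] {n : WithTop ℕ∞} {f : D → E →L[ℝ] F} {x : D}
    (h : ∀ v, ContDiffAt ℝ n (fun y ↦ f y v) x) : ContDiffAt ℝ n f x := by
  rw [← contDiffWithinAt_univ]
  let d := Module.finrank ℝ E
  have hd : d = Module.finrank ℝ (Fin d → ℝ) := (Module.finrank_fin_fun ℝ).symm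
  let e₁ := ContinuousLinearEquiv.ofFinrankEq hd
  let e₂ := (e₁.arrowCongr (1 : F ≃L[ℝ] F)).trans (ContinuousLinearEquiv.piRing (Fin d))
  rw [← Function.id_comp f, ← e₂.symm_comp_self, contDiffWithinAt_univ]
  exact e₂.symm.contDiff.contDiffAt.comp x (contDiffAt_pi.mpr fun i ↦ h _)

/-- The map `(ι → ℝ) → E` given by a family of vectors. -/
def frameMap (X : ι → E) : (ι → ℝ) →L[ℝ] E :=
  ∑ i, (ContinuousLinearMap.proj i : (ι → ℝ) →L[ℝ] ℝ).smulRight (X i)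

omit [DecidableEq ι] [FiniteDimensional ℝ E] in
theorem frameMap_apply (X : ι → E) (v : ι → ℝ) : frameMap X v = ∑ i, v i • X i := by
  simp [frameMap]

/-- The bilinear form on `ι → ℝ` with matrix `q`. -/
def bilinOfMatrix (q : Matrix ι ι ℝ) : (ι → ℝ) →L[ℝ] (ι → ℝ) →L[ℝ] ℝ :=
  ∑ i, ∑ j, q i j • (ContinuousLinearMap.proj i : (ι → ℝ) →L[ℝ] ℝ).smulRight
    (ContinuousLinearMap.proj j : (ι → ℝ) →L[ℝ] ℝ)

omit [DecidableEq ι] in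
theorem bilinOfMatrix_apply (q : Matrix ι ι ℝ) (v w : ι → ℝ) :
    bilinOfMatrix q v w = ∑ i, ∑ j, q i j * (v i * w j) := by
  simp [bilinOfMatrix]

/-- A bilinear form with invertible Gram matrix in a basis is invertible. -/
theorem isInvertible_of_gram {b : E →L[ℝ] E →L[ℝ] ℝ} (B : Module.Basis ι ℝ E)
    (hb : ∀ i j, b (B i) (B j) = q i j) (hq : IsUnit q.det) : b.IsInvertible := by
  have hinj : Function.Injective b := by
    rw [injective_iff_map_eq_zero]
    intro v hv
    have h : (fun i ↦ B.repr v i) ᵥ* q = 0 := by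
      ext j
      have := DFunLike.congr_fun hv (B j)
      rw [← B.sum_repr v] at this
      simp only [map_sum, map_smul, _root_.sum_apply, _root_.smul_apply, hb,
        _root_.zero_apply, smul_eq_mul] at this
      simpa only [vecMul, dotProduct, Pi.zero_apply] using this
    have h0 : (fun i ↦ B.repr v i) = 0 := by
      have := congrArg (· ᵥ* q⁻¹) h
      simpa [vecMul_vecMul, mul_nonsing_inv _ hq] using this
    rw [← B.sum_repr v]
    simp [show ∀ i, B.repr v i = 0 from congrFun h0]
  have hdim : Module.finrank ℝ E = Module.finrank ℝ (E →L[ℝ] ℝ) := by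
    rw [← LinearMap.toContinuousLinearMap.finrank_eq]
    exact (Subspace.dual_finrank_eq (K := ℝ) (V := E)).symm
  refine ⟨(LinearEquiv.ofInjectiveOfFinrankEq (b : E →ₗ[ℝ] E →L[ℝ] ℝ) hinj
    hdim).toContinuousLinearEquiv, ?_⟩
  ext v w
  rfl

omit [DecidableEq ι] in
theorem isInvertible_frameMap {X : ι → E} (hli : LinearIndependent ℝ X)
    (hcard : Fintype.card ι = Module.finrank ℝ E) : (frameMap X).IsInvertible := by
  let B := basisOfLinearIndependentOfCardEqFinrank' _ hli hcard
  refine ⟨B.equivFun.symm.toContinuousLinearEquiv, ?_⟩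
  refine ContinuousLinearMap.ext fun v ↦ ?_
  simp [B, frameMap_apply, Module.Basis.equivFun_symm_apply]

omit [DecidableEq ι] in
/-- A field of bilinear forms with constant coefficients in a smooth frame is smooth. -/
theorem contDiffAt_of_gram {n : WithTop ℕ∞} {b : E → E →L[ℝ] E →L[ℝ] ℝ} {X : ι → E → E} {y₀ : E}
    (hX : ∀ i, ContDiffAt ℝ n (X i) y₀)
    (hli : ∀ᶠ y in 𝓝 y₀, LinearIndependent ℝ fun i ↦ X i y)
    (hcard : Fintype.card ι = Module.finrank ℝ E)
    (hb : ∀ᶠ y in 𝓝 y₀, ∀ i j, b y (X i y) (X j y) = q i j) : ContDiffAt ℝ n b y₀ := by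
  have hA : ContDiffAt ℝ n (fun y ↦ frameMap fun i ↦ X i y) y₀ := by
    refine contDiffAt_clm_of_apply fun v ↦ ?_
    simp only [frameMap_apply]
    exact ContDiffAt.sum fun i _ ↦ contDiffAt_const.smul (hX i)
  have hP : ContDiffAt ℝ n (fun y ↦ (frameMap fun i ↦ X i y).inverse) y₀ :=
    ContDiffAt.comp (g := ContinuousLinearMap.inverse) y₀
      (isInvertible_frameMap hli.self_of_nhds hcard).contDiffAt_map_inverse hA
  -- In frame coordinates the form is the constant `q`, so `b` is the pullback of `bilinOfMatrix q`
  -- by the inverse frame map, and inversion is smooth at invertible maps.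
  have hev : (fun y ↦ b y) =ᶠ[𝓝 y₀] fun y ↦ (bilinOfMatrix q).bilinearComp
      (frameMap fun i ↦ X i y).inverse (frameMap fun i ↦ X i y).inverse := by
    filter_upwards [hli, hb] with y hy hby
    have hinv := isInvertible_frameMap hy hcard
    ext v w
    obtain ⟨v, rfl⟩ := hinv.bijective.2 v
    obtain ⟨w, rfl⟩ := hinv.bijective.2 w
    simp only [ContinuousLinearMap.bilinearComp_apply, hinv.inverse_apply_self]
    simp [bilinOfMatrix_apply, frameMap_apply, hby, Finset.mul_sum, mul_left_comm, mul_comm]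
    exact Finset.sum_comm
  refine ContDiffAt.congr_of_eventuallyEq ?_ hev
  refine contDiffAt_clm_of_apply fun v ↦ contDiffAt_clm_of_apply fun w ↦ ?_
  simp only [ContinuousLinearMap.bilinearComp_apply]
  exact (contDiffAt_const.clm_apply (hP.clm_apply contDiffAt_const)).clm_apply
    (hP.clm_apply contDiffAt_const)

theorem contDiffAt_christoffel {n : WithTop ℕ∞} {b : E → E →L[ℝ] E →L[ℝ] ℝ} {y₀ : E}
    (hb : ContDiffAt ℝ (n + 1) b y₀) (hinv : (b y₀).IsInvertible) :
    ContDiffAt ℝ n (CoordMetric.christoffel b) y₀ := by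
  have hD : ContDiffAt ℝ n (fderiv ℝ b) y₀ := hb.fderiv_right le_rfl
  have hD' (u v w : E) : ContDiffAt ℝ n (fun y ↦ fderiv ℝ b y u v w) y₀ :=
    ((hD.clm_apply contDiffAt_const).clm_apply contDiffAt_const).clm_apply contDiffAt_const
  have hI : ContDiffAt ℝ n (fun y ↦ (b y).inverse) y₀ :=
    ContDiffAt.comp (g := ContinuousLinearMap.inverse) y₀ hinv.contDiffAt_map_inverse
      (hb.of_le le_self_add)
  refine contDiffAt_clm_of_apply fun v ↦ contDiffAt_clm_of_apply fun w ↦ ?_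
  simp only [CoordMetric.christoffel_apply]
  refine hI.clm_apply (contDiffAt_clm_of_apply fun z ↦ ?_)
  simp only [CoordMetric.christoffelLower_apply]
  exact contDiffAt_const.mul (((hD' _ _ _).add (hD' _ _ _)).sub (hD' _ _ _))

/-- The Koszul formula in a frame in which the metric and the brackets have constant
coefficients. -/
theorem christoffel_frame {b : E → E →L[ℝ] E →L[ℝ] ℝ} {X : ι → E → E} {y : E}
    (hX : ∀ i, DifferentiableAt ℝ (X i) y) (hbd : DifferentiableAt ℝ b y)
    (hli : LinearIndependent ℝ fun i ↦ X i y) (hcard : Fintype.card ι = Module.finrank ℝ E)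
    (hb : ∀ᶠ z in 𝓝 y, ∀ i j, b z (X i z) (X j z) = q i j) (hqs : q.IsSymm)
    (hq : IsUnit q.det)
    (hc : ∀ i j, VectorField.lieBracket ℝ (X i) (X j) y = ∑ k, c i j k • X k y) (i j : ι) :
    CoordMetric.christoffel b y (X i y) (X j y) =
      ∑ k, frameConn c q i j k • X k y - fderiv ℝ (X j) y (X i y) := by
  let B := basisOfLinearIndependentOfCardEqFinrank' _ hli hcard
  have hB (i : ι) : B i = X i y := by simp [B]
  have hby := hb.self_of_nhds
  have hinv : (b y).IsInvertible := isInvertible_of_gram (q := q) B (by simpa [hB] using hby) hq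
  have hsymm (v w : E) : b y v w = b y w v := by
    rw [← B.sum_repr v, ← B.sum_repr w]
    simp only [map_sum, map_smul, _root_.sum_apply, _root_.smul_apply, hB, hby, smul_eq_mul,
      Finset.mul_sum]
    rw [Finset.sum_comm]
    refine Finset.sum_congr rfl fun i _ ↦ Finset.sum_congr rfl fun j _ ↦ ?_
    rw [hqs.apply]
    ring
  -- Differentiating the constant `b (X i) (X j)` trades derivatives of the metric for derivatives
  -- of the frame; in the Koszul formula these then combine into brackets.
  have hDb (v : E) (i j : ι) : fderiv ℝ b y v (X i y) (X j y) =
      -b y (fderiv ℝ (X i) y v) (X j y) - b y (X i y) (fderiv ℝ (X j) y v) := by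
    have h1 := ((hbd.hasFDerivAt.clm_apply (hX i).hasFDerivAt).clm_apply (hX j).hasFDerivAt)
    have h2 : (fun z ↦ b z (X i z) (X j z)) =ᶠ[𝓝 y] fun _ ↦ q i j := by
      filter_upwards [hb] with z hz using hz i j
    have h3 := DFunLike.congr_fun (h1.unique ((hasFDerivAt_const _ _).congr_of_eventuallyEq h2)) v
    simp at h3
    linarith
  have hbr (i j m : ι) : b y (fderiv ℝ (X j) y (X i y)) (X m y)
      - b y (fderiv ℝ (X i) y (X j y)) (X m y) = ∑ l, c i j l * q l m := by
    have := congrArg (fun v ↦ b y v (X m y)) (hc i j)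
    simpa [VectorField.lieBracket, hby] using this
  apply hinv.bijective.1
  have hΓ : b y (CoordMetric.christoffel b y (X i y) (X j y)) =
      CoordMetric.christoffelLower b y (X i y) (X j y) := by
    rw [CoordMetric.christoffel_apply, hinv.self_apply_inverse]
  rw [hΓ]
  apply ContinuousLinearMap.coe_injective
  refine B.ext fun m ↦ ?_
  have hω : b y (∑ k, frameConn c q i j k • X k y) (X m y) =
      (1 / 2 : ℝ) * ∑ l, (c i j l * q l m - c j m l * q l i + c m i l * q l j) := by
    rw [← sum_frameConn_mul hq]
    simp [hby]
  rw [Finset.sum_add_distrib, Finset.sum_sub_distrib, ← hbr, ← hbr, ← hbr] at hω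
  rw [hB, ContinuousLinearMap.coe_coe, ContinuousLinearMap.coe_coe, map_sub, _root_.sub_apply, hω,
    CoordMetric.christoffelLower_apply, hDb, hDb, hDb, hsymm (X j y), hsymm (X i y),
    hsymm (X i y)]
  ring

/-- The curvature of a metric in a frame in which the metric and the brackets have constant
coefficients. -/
theorem curvature_frame {b : E → E →L[ℝ] E →L[ℝ] ℝ} {X : ι → E → E} {y₀ : E}
    (hX : ∀ i, ContDiffAt ℝ 2 (X i) y₀)
    (hli : ∀ᶠ y in 𝓝 y₀, LinearIndependent ℝ fun i ↦ X i y)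
    (hcard : Fintype.card ι = Module.finrank ℝ E)
    (hb : ∀ᶠ y in 𝓝 y₀, ∀ i j, b y (X i y) (X j y) = q i j) (hqs : q.IsSymm)
    (hq : IsUnit q.det)
    (hc : ∀ᶠ y in 𝓝 y₀, ∀ i j,
      VectorField.lieBracket ℝ (X i) (X j) y = ∑ k, c i j k • X k y) (i j k : ι) :
    CoordMetric.curvature b y₀ (X j y₀) (X k y₀) (X i y₀) =
      ∑ m, frameCurvature c q i j k m • X m y₀ := by
  let B := basisOfLinearIndependentOfCardEqFinrank' _ hli.self_of_nhds hcard
  have hB (i : ι) : B i = X i y₀ := by simp [B]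
  have hinv : (b y₀).IsInvertible :=
    isInvertible_of_gram (q := q) B (by simpa [hB] using hb.self_of_nhds) hq
  have hbs : ContDiffAt ℝ 2 b y₀ := contDiffAt_of_gram hX hli hcard hb
  have hΓd : DifferentiableAt ℝ (CoordMetric.christoffel b) y₀ :=
    (contDiffAt_christoffel (n := 1) (by simpa [one_add_one_eq_two] using hbs)
      hinv).differentiableAt one_ne_zero
  have hXd (i : ι) : DifferentiableAt ℝ (X i) y₀ := (hX i).differentiableAt two_ne_zero
  have hDX (i : ι) : DifferentiableAt ℝ (fderiv ℝ (X i)) y₀ :=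
    ((hX i).fderiv_right (m := 1) (by norm_num)).differentiableAt one_ne_zero
  set Γ := CoordMetric.christoffel b with hΓ
  -- This is `∂X j + Γ(X i, X j) = ∇_{X i} X j`. It is needed on a neighbourhood because it is
  -- differentiated next.
  have hev (i j : ι) : ∀ᶠ y in 𝓝 y₀, Γ y (X i y) (X j y) =
      ∑ k, frameConn c q i j k • X k y - fderiv ℝ (X j) y (X i y) := by
    have h1 : ∀ᶠ y in 𝓝 y₀, ∀ i, DifferentiableAt ℝ (X i) y := by
      rw [eventually_all]
      intro i
      filter_upwards [(hX i).eventually (by simp)] with y hy using hy.differentiableAt two_ne_zero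
    filter_upwards [h1, hbs.eventually (by simp), hli, hb.eventually_nhds, hc]
      with y h1 h2 h3 h4 h5
    exact christoffel_frame h1 (h2.differentiableAt two_ne_zero) h3 hcard h4 hqs hq h5 i j
  have hΓ0 (i j : ι) := (hev i j).self_of_nhds
  have hDΓ (i j k : ι) : fderiv ℝ Γ y₀ (X i y₀) (X j y₀) (X k y₀) =
      ∑ l, frameConn c q j k l • fderiv ℝ (X l) y₀ (X i y₀)
        - fderiv ℝ (fderiv ℝ (X k)) y₀ (X i y₀) (X j y₀)
        - fderiv ℝ (X k) y₀ (fderiv ℝ (X j) y₀ (X i y₀))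
        - Γ y₀ (fderiv ℝ (X j) y₀ (X i y₀)) (X k y₀)
        - Γ y₀ (X j y₀) (fderiv ℝ (X k) y₀ (X i y₀)) := by
    have h1 := (hΓd.hasFDerivAt.clm_apply (hXd j).hasFDerivAt).clm_apply (hXd k).hasFDerivAt
    have h2 := (HasFDerivAt.fun_sum fun l (_ : l ∈ Finset.univ) ↦
      (hXd l).hasFDerivAt.const_smul (frameConn c q j k l)).sub
        ((hDX k).hasFDerivAt.clm_apply (hXd j).hasFDerivAt)
    have h3 := DFunLike.congr_fun (h1.unique (h2.congr_of_eventuallyEq (hev j k))) (X i y₀)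
    simp at h3
    rw [← sub_eq_zero] at h3 ⊢
    rw [← h3]
    abel
  -- The second derivatives of the frame cancel upon antisymmetrizing in `i` and `j`.
  have hsnd : fderiv ℝ (fderiv ℝ (X k)) y₀ (X i y₀) (X j y₀) =
      fderiv ℝ (fderiv ℝ (X k)) y₀ (X j y₀) (X i y₀) :=
    ((hX k).isSymmSndFDerivAt (by simp)).eq _ _
  have hbr : fderiv ℝ (X j) y₀ (X i y₀) - fderiv ℝ (X i) y₀ (X j y₀) =
      ∑ l, c i j l • X l y₀ := by
    simpa [VectorField.lieBracket] using hc.self_of_nhds i j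
  -- The surviving first-order terms assemble to `∇_{[X i, X j]} X k`, the last term of the
  -- curvature.
  have hbrΓ : Γ y₀ (fderiv ℝ (X j) y₀ (X i y₀)) (X k y₀)
      - Γ y₀ (fderiv ℝ (X i) y₀ (X j y₀)) (X k y₀)
      + (fderiv ℝ (X k) y₀ (fderiv ℝ (X j) y₀ (X i y₀))
        - fderiv ℝ (X k) y₀ (fderiv ℝ (X i) y₀ (X j y₀))) =
      ∑ l, c i j l • ∑ m, frameConn c q l k m • X m y₀ := by
    rw [← map_sub, ← _root_.sub_apply, ← map_sub, hbr]
    simp [hΓ0, smul_sub]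
  have hΓΓ (i j k : ι) : Γ y₀ (X i y₀) (Γ y₀ (X j y₀) (X k y₀)) =
      ∑ l, frameConn c q j k l • ∑ m, frameConn c q i l m • X m y₀
        - ∑ l, frameConn c q j k l • fderiv ℝ (X l) y₀ (X i y₀)
        - Γ y₀ (X i y₀) (fderiv ℝ (X k) y₀ (X j y₀)) := by
    rw [hΓ0 j k]
    simp [hΓ0, smul_sub]
  have hR : CoordMetric.curvature b y₀ (X j y₀) (X k y₀) (X i y₀) =
      fderiv ℝ Γ y₀ (X i y₀) (X j y₀) (X k y₀) - fderiv ℝ Γ y₀ (X j y₀) (X i y₀) (X k y₀)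
      + Γ y₀ (X i y₀) (Γ y₀ (X j y₀) (X k y₀)) - Γ y₀ (X j y₀) (Γ y₀ (X i y₀) (X k y₀)) := rfl
  have hsum : ∑ m, frameCurvature c q i j k m • X m y₀ =
      ∑ l, frameConn c q j k l • ∑ m, frameConn c q i l m • X m y₀
      - ∑ l, frameConn c q i k l • ∑ m, frameConn c q j l m • X m y₀
      - ∑ l, c i j l • ∑ m, frameConn c q l k m • X m y₀ := by
    simp only [frameCurvature, Finset.sum_smul, Finset.smul_sum, smul_smul]
    rw [Finset.sum_comm]
    simp only [← Finset.sum_sub_distrib, sub_smul]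
  rw [hR, hDΓ i j k, hDΓ j i k, hΓΓ i j k, hΓΓ j i k, hsum, ← hbrΓ, hsnd]
  abel

/-- The Ricci tensor of a metric in a frame in which the metric and the brackets have constant
coefficients. -/
theorem ricci_frame {b : E → E →L[ℝ] E →L[ℝ] ℝ} {X : ι → E → E} {y₀ : E}
    (hX : ∀ i, ContDiffAt ℝ 2 (X i) y₀)
    (hli : ∀ᶠ y in 𝓝 y₀, LinearIndependent ℝ fun i ↦ X i y)
    (hcard : Fintype.card ι = Module.finrank ℝ E)
    (hb : ∀ᶠ y in 𝓝 y₀, ∀ i j, b y (X i y) (X j y) = q i j) (hqs : q.IsSymm)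
    (hq : IsUnit q.det)
    (hc : ∀ᶠ y in 𝓝 y₀, ∀ i j,
      VectorField.lieBracket ℝ (X i) (X j) y = ∑ k, c i j k • X k y) (j k : ι) :
    CoordMetric.ricci b y₀ (X j y₀) (X k y₀) = frameRicci c q j k := by
  let B := basisOfLinearIndependentOfCardEqFinrank' _ hli.self_of_nhds hcard
  have hB (i : ι) : B i = X i y₀ := by simp [B]
  rw [CoordMetric.ricci, LinearMap.trace_eq_matrix_trace ℝ B, Matrix.trace, frameRicci]
  refine Finset.sum_congr rfl fun i _ ↦ ?_
  rw [Matrix.diag_apply, LinearMap.toMatrix_apply, hB,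
    curvature_frame hX hli hcard hb hqs hq hc i j k]
  simp only [← hB]
  rw [B.repr_sum_self]

end FrameCurvature

/-! ### Left-invariant metrics in left-invariant frames -/

section LeftInvariant

open VectorField

variable {ι : Type*} [Fintype ι] [DecidableEq ι]
  {E : Type*} [NormedAddCommGroup E] [NormedSpace ℝ E] [FiniteDimensional ℝ E]
  {G : Type*} [TopologicalSpace G] [ChartedSpace E G] [Group G] [LieGroup 𝓘(ℝ, E) ∞ G]

omit [FiniteDimensional ℝ E] in
theorem isInvertible_mfderiv_mul_left (p x : G) :
    (mfderiv 𝓘(ℝ, E) 𝓘(ℝ, E) (fun y ↦ p * y) x).IsInvertible := by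
  have hd (p x : G) : MDifferentiableAt 𝓘(ℝ, E) 𝓘(ℝ, E) (fun y ↦ p * y) x :=
    (contMDiff_mul_left (I := 𝓘(ℝ, E)) (n := ∞)).contMDiffAt.mdifferentiableAt (by simp)
  have hcomp (p x : G) : (mfderiv 𝓘(ℝ, E) 𝓘(ℝ, E) (fun y ↦ p⁻¹ * y) (p * x)).comp
      (mfderiv 𝓘(ℝ, E) 𝓘(ℝ, E) (fun y ↦ p * y) x) = ContinuousLinearMap.id _ _ := by
    rw [← mfderiv_comp (I' := 𝓘(ℝ, E)) x (hd _ _) (hd _ _)]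
    have : (fun y ↦ p⁻¹ * y) ∘ (fun y ↦ p * y) = (id : G → G) := by ext; simp
    rw [this, mfderiv_id]
  have hcomp' : (mfderiv 𝓘(ℝ, E) 𝓘(ℝ, E) (fun y ↦ p * y) x).comp
      (mfderiv 𝓘(ℝ, E) 𝓘(ℝ, E) (fun y ↦ p⁻¹ * y) (p * x)) = ContinuousLinearMap.id _ _ := by
    have h := hcomp p⁻¹ (p * x)
    rw [inv_mul_cancel_left, inv_mul_cancel_left, inv_inv] at h
    exact h
  exact .of_inverse hcomp' (hcomp p x)

omit [Fintype ι] [DecidableEq ι] [FiniteDimensional ℝ E] in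
theorem linearIndependent_mulInvariantVectorField {e : ι → GroupLieAlgebra 𝓘(ℝ, E) G}
    (he : LinearIndependent ℝ e) (x : G) :
    LinearIndependent ℝ fun i ↦ (mulInvariantVectorField (e i) x : TangentSpace 𝓘(ℝ, E) x) := by
  exact he.map' (mfderiv 𝓘(ℝ, E) 𝓘(ℝ, E) (fun y ↦ x * y) 1).toLinearMap
    (LinearMap.ker_eq_bot.2 (isInvertible_mfderiv_mul_left x 1).injective)

omit [FiniteDimensional ℝ E] in
theorem SmoothMetric.IsLeftInvariant.inner_mulInvariantVectorField {g : SmoothMetric E G}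
    (hg : g.IsLeftInvariant) (v w : GroupLieAlgebra 𝓘(ℝ, E) G) (x : G) :
    g.inner x (mulInvariantVectorField v x) (mulInvariantVectorField w x) = g.lieInner v w := by
  -- Left translation by `x` lands at `x * 1`, which is only propositionally `x`. Viewing the
  -- tangent spaces as the model space `E` lets the base point be changed by substitution.
  have h : ∀ z, z = x → ∀ a b : E, (g.inner z : E →L[ℝ] E →L[ℝ] ℝ) a b =
      (g.inner x : E →L[ℝ] E →L[ℝ] ℝ) a b := by
    rintro _ rfl a b
    rfl
  exact (h _ (mul_one x) _ _).symm.trans (hg x 1 v w)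

omit [FiniteDimensional ℝ E] in
theorem SmoothMetric.lieInner_comm (g : SmoothMetric E G)
    (v w : GroupLieAlgebra 𝓘(ℝ, E) G) : g.lieInner v w = g.lieInner w v :=
  g.symm 1 v w

omit [FiniteDimensional ℝ E] [DecidableEq ι] in
theorem SmoothMetric.lieInner_sum_sum (g : SmoothMetric E G)
    (e : ι → GroupLieAlgebra 𝓘(ℝ, E) G) (u v : ι → ℝ) :
    g.lieInner (∑ i, u i • e i) (∑ j, v j • e j) =
      ∑ i, ∑ j, u i * v j * g.lieInner (e i) (e j) := by
  let B : E →L[ℝ] E →L[ℝ] ℝ := g.inner 1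
  let f : ι → E := e
  change B (∑ i, u i • f i) (∑ j, v j • f j) = ∑ i, ∑ j, u i * v j * B (f i) (f j)
  simp only [map_sum, map_smul, _root_.sum_apply, _root_.smul_apply, smul_eq_mul, Finset.mul_sum]
  rw [Finset.sum_comm]
  exact Finset.sum_congr rfl fun i _ ↦ Finset.sum_congr rfl fun j _ ↦ by ring

-- A kernel vector of the Gram matrix would give a nonzero vector of length zero.
omit [FiniteDimensional ℝ E] in
theorem SmoothMetric.isUnit_det_gram (g : SmoothMetric E G)
    {e : ι → GroupLieAlgebra 𝓘(ℝ, E) G} (he : LinearIndependent ℝ e) :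
    IsUnit (Matrix.of fun i j ↦ g.lieInner (e i) (e j)).det := by
  rw [isUnit_iff_ne_zero]
  intro h
  obtain ⟨u, hu, hu0⟩ := Matrix.exists_vecMul_eq_zero_iff.2 h
  have h1 : g.lieInner (∑ i, u i • e i) (∑ j, u j • e j) = 0 := by
    rw [g.lieInner_sum_sum, Finset.sum_comm]
    refine Finset.sum_eq_zero fun j _ ↦ ?_
    have := congrFun hu0 j
    simp only [vecMul, dotProduct, Matrix.of_apply, Pi.zero_apply] at this
    rw [← mul_zero (u j), ← this, Finset.mul_sum]
    exact Finset.sum_congr rfl fun i _ ↦ by ring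
  refine hu (funext fun i ↦ ?_)
  by_contra hne
  have h2 : ∑ i, u i • e i ≠ 0 := fun h0 ↦
    hne (Fintype.linearIndependent_iff.1 he u h0 i)
  exact (g.pos 1 _ h2).ne' h1

/-- The Ricci tensor of a left-invariant metric in a left-invariant frame. -/
theorem SmoothMetric.IsLeftInvariant.ricci_mulInvariantVectorField {g : SmoothMetric E G}
    (hg : g.IsLeftInvariant) {e : ι → GroupLieAlgebra 𝓘(ℝ, E) G}
    (he : LinearIndependent ℝ e) (hcard : Fintype.card ι = Module.finrank ℝ E)
    {c : ι → ι → ι → ℝ} (hc : ∀ i j, ⁅e i, e j⁆ = ∑ k, c i j k • e k) (x : G) (j k : ι) :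
    g.ricci x (mulInvariantVectorField (e j) x) (mulInvariantVectorField (e k) x) =
      frameRicci c (Matrix.of fun i j ↦ g.lieInner (e i) (e j)) j k := by
  set φ := extChartAt 𝓘(ℝ, E) x with hφ
  set X : ι → E → E := fun i ↦
    mpullback 𝓘(ℝ, E) 𝓘(ℝ, E) φ.symm (mulInvariantVectorField (e i)) with hX
  have hinv : ∀ y ∈ φ.target, (mfderiv 𝓘(ℝ, E) 𝓘(ℝ, E) φ.symm y).IsInvertible := by
    intro y hy
    have := isInvertible_mfderivWithin_extChartAt_symm (I := 𝓘(ℝ, E)) hy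
    rwa [modelWithCornersSelf_coe, range_id, mfderivWithin_univ] at this
  -- At the centre of its own preferred chart the inverse chart has derivative the identity, so the
  -- pulled-back frame there is the original one.
  have hself : ∀ i, X i (φ x) = (mulInvariantVectorField (e i) x : TangentSpace 𝓘(ℝ, E) x) := by
    intro i
    have h := mfderivWithin_range_extChartAt_symm (I := 𝓘(ℝ, E)) (x := x)
    rw [modelWithCornersSelf_coe, range_id, mfderivWithin_univ] at h
    have h' : ∀ z, z = x → (mulInvariantVectorField (I := 𝓘(ℝ, E)) (e i) z : E) =
        (mulInvariantVectorField (I := 𝓘(ℝ, E)) (e i) x : E) := by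
      rintro _ rfl
      rfl
    have h2 : X i (φ x) = (ContinuousLinearMap.inverse (M := E) (M₂ := E)
      (mfderiv 𝓘(ℝ, E) 𝓘(ℝ, E) φ.symm (φ x)) : E →L[ℝ] E)
      (mulInvariantVectorField (e i) (φ.symm (φ x))) := rfl
    have h3 : (mfderiv 𝓘(ℝ, E) 𝓘(ℝ, E) φ.symm (φ x) : E →L[ℝ] E) = ContinuousLinearMap.id ℝ E := h
    rw [h2, h3, ContinuousLinearMap.inverse_id]
    exact h' _ (extChartAt_to_inv x)
  have htarget : φ.target ∈ 𝓝 (φ x) := extChartAt_target_mem_nhds x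
  have hsm : ∀ y ∈ φ.target, ContMDiffAt 𝓘(ℝ, E) 𝓘(ℝ, E) ∞ φ.symm y := by
    intro y hy
    exact (contMDiffOn_extChartAt_symm x).contMDiffAt ((isOpen_extChartAt_target x).mem_nhds hy)
  have key := ricci_frame (b := g.inChart x) (X := X) (y₀ := φ x) (c := c)
    (q := Matrix.of fun i j ↦ g.lieInner (e i) (e j)) ?_ ?_ hcard ?_ ?_ ?_ ?_ j k
  · rw [hself, hself] at key
    exact key
  · intro i
    have := ContMDiffAt.mpullback_vectorField_preimage (m := 2) (n := ∞) (f := φ.symm)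
      (x₀ := φ x) (I := 𝓘(ℝ, E)) (I' := 𝓘(ℝ, E)) (V := mulInvariantVectorField (e i)) ?_
      (hsm _ (mem_of_mem_nhds htarget)) (hinv _ (mem_of_mem_nhds htarget)) ?_
    · rw [contMDiffAt_vectorSpace_iff_contDiffAt] at this
      exact this
    · have := contMDiffAt_mulInvariantVectorField (I := 𝓘(ℝ, E)) (e i) (g := φ.symm (φ x))
      simpa using this
    · exact WithTop.coe_le_coe.2 le_top
  · filter_upwards [htarget] with y hy
    have := linearIndependent_mulInvariantVectorField he (φ.symm y)
    exact this.map' (mfderiv 𝓘(ℝ, E) 𝓘(ℝ, E) φ.symm y).inverse.toLinearMap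
      (LinearMap.ker_eq_bot.2 (hinv y hy).inverse.injective)
  · filter_upwards [htarget] with y hy i j
    rw [SmoothMetric.inChart_apply]
    simp only [hX, mpullback_apply]
    rw [(hinv y hy).self_apply_inverse, (hinv y hy).self_apply_inverse,
      hg.inner_mulInvariantVectorField]
    rfl
  · ext i j
    exact g.symm 1 _ _
  · exact g.isUnit_det_gram he
  · filter_upwards [htarget] with y hy i j
    -- Pullback commutes with brackets, and the bracket of left-invariant fields extends the Lie
    -- algebra bracket; hence the chart frame has the same constants `c`.
    have h1 := mpullback_mlieBracket (n := ∞) (I := 𝓘(ℝ, E)) (I' := 𝓘(ℝ, E)) (f := φ.symm)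
      (x₀ := y) (mdifferentiableAt_mulInvariantVectorField (e i))
      (mdifferentiableAt_mulInvariantVectorField (e j))
      (hsm y hy) (by simp; exact WithTop.coe_le_coe.2 le_top)
    rw [← mulInvariantVector_mlieBracket, ← GroupLieAlgebra.bracket_def, hc,
      ← mlieBracketWithin_univ (I := 𝓘(ℝ, E)) (M := E), mlieBracketWithin_eq_lieBracketWithin] at h1
    refine (congrFun (lieBracketWithin_univ (𝕜 := ℝ) (V := X i) (W := X j)) y).symm.trans
      (h1.symm.trans ?_)
    let T : GroupLieAlgebra 𝓘(ℝ, E) G →L[ℝ] E :=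
      (mfderiv 𝓘(ℝ, E) 𝓘(ℝ, E) φ.symm y).inverse.comp
        (mfderiv 𝓘(ℝ, E) 𝓘(ℝ, E) (fun z ↦ φ.symm y * z) 1)
    exact (map_sum T _ _).trans (Finset.sum_congr rfl fun l _ ↦ map_smul T _ _)

end LeftInvariant

/-! ### Smoothness of left-invariant fields and one-forms; the orthonormal coframe. -/

section DiagonalMetric

open VectorField Bundle

section Smooth

variable {E : Type*} [NormedAddCommGroup E] [NormedSpace ℝ E]

/-- Left-invariant vector fields on a smooth Lie group are smooth. -/
theorem contMDiff_infty_mulInvariantVectorField {G : Type*} [TopologicalSpace G]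
    [ChartedSpace E G] [Group G] [LieGroup 𝓘(ℝ, E) ∞ G] (v : GroupLieAlgebra 𝓘(ℝ, E) G) :
    ContMDiff 𝓘(ℝ, E) 𝓘(ℝ, E).tangent ∞
      (fun g : G ↦ (mulInvariantVectorField v g : TangentBundle 𝓘(ℝ, E) G)) := by
  -- The field is the tangent map of multiplication applied to the pair (zero vector at `g`, `v` at
  -- `1`), a composite of smooth maps.
  let fg : G → TangentBundle 𝓘(ℝ, E) G := fun g ↦ TotalSpace.mk' E g 0
  have sfg : ContMDiff 𝓘(ℝ, E) 𝓘(ℝ, E).tangent ∞ fg := contMDiff_zeroSection _ _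
  let fv : G → TangentBundle 𝓘(ℝ, E) G := fun _ ↦ TotalSpace.mk' E 1 v
  have sfv : ContMDiff 𝓘(ℝ, E) 𝓘(ℝ, E).tangent ∞ fv := contMDiff_const
  let F₁ : G → (TangentBundle 𝓘(ℝ, E) G × TangentBundle 𝓘(ℝ, E) G) := fun g ↦ (fg g, fv g)
  have S₁ : ContMDiff _ _ ∞ F₁ := sfg.prodMk sfv
  let F₂ : (TangentBundle 𝓘(ℝ, E) G × TangentBundle 𝓘(ℝ, E) G) →
      TangentBundle (𝓘(ℝ, E).prod 𝓘(ℝ, E)) (G × G) :=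
    (equivTangentBundleProd 𝓘(ℝ, E) G 𝓘(ℝ, E) G).symm
  have S₂ : ContMDiff _ _ ∞ F₂ := contMDiff_equivTangentBundleProd_symm
  let F₃ : TangentBundle (𝓘(ℝ, E).prod 𝓘(ℝ, E)) (G × G) → TangentBundle 𝓘(ℝ, E) G :=
    tangentMap% (fun (p : G × G) ↦ p.1 * p.2)
  have S₃ : ContMDiff _ _ ∞ F₃ :=
    ContMDiff.contMDiff_tangentMap (contMDiff_mul 𝓘(ℝ, E) ∞) (m := ∞) le_rfl
  let S := (S₃.comp S₂).comp S₁
  convert! S with g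
  · simp [F₁, F₂, F₃, fg, fv]
  · simp only [Function.comp_apply, tangentMap, F₃, F₂, F₁, fg, fv]
    rw [mfderiv_prod_eq_add_apply ((contMDiff_mul 𝓘(ℝ, E) ∞).mdifferentiableAt (by simp))]
    let A : E →L[ℝ] E := mfderiv 𝓘(ℝ, E) 𝓘(ℝ, E) (fun z : G ↦ z * 1) g
    let B : E →L[ℝ] E := mfderiv 𝓘(ℝ, E) 𝓘(ℝ, E) (fun z : G ↦ g * z) 1
    change B v = A 0 + B v
    rw [map_zero, zero_add]

variable {M : Type*} [TopologicalSpace M] [ChartedSpace E M] [IsManifold 𝓘(ℝ, E) ∞ M]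

/-- The contraction of a smooth metric with a smooth vector field is a smooth one-form. -/
theorem SmoothMetric.contMDiff_contract (g : SmoothMetric E M) {X : ∀ x : M, TangentSpace 𝓘(ℝ, E) x}
    (hX : ContMDiff 𝓘(ℝ, E) 𝓘(ℝ, E).tangent ∞ (fun x ↦ (X x : TangentBundle 𝓘(ℝ, E) M))) :
    ContMDiff 𝓘(ℝ, E) (𝓘(ℝ, E).prod 𝓘(ℝ, E →L[ℝ] ℝ)) ∞
      (fun x ↦ TotalSpace.mk' (E →L[ℝ] ℝ) (E := fun x ↦ (TangentSpace 𝓘(ℝ, E) x →L[ℝ] ℝ))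
        x (g.inner x (X x))) :=
  g.contMDiff.clm_bundle_apply (b := fun x ↦ x) hX

/-- The tensor square of a smooth one-form is smooth. -/
theorem contMDiff_smulRight_oneForm {θ : ∀ x : M, TangentSpace 𝓘(ℝ, E) x →L[ℝ] ℝ}
    (hθ : ContMDiff 𝓘(ℝ, E) (𝓘(ℝ, E).prod 𝓘(ℝ, E →L[ℝ] ℝ)) ∞
      (fun x ↦ TotalSpace.mk' (E →L[ℝ] ℝ) (E := fun x ↦ (TangentSpace 𝓘(ℝ, E) x →L[ℝ] ℝ))
        x (θ x))) :
    ContMDiff 𝓘(ℝ, E) (𝓘(ℝ, E).prod 𝓘(ℝ, E →L[ℝ] E →L[ℝ] ℝ)) ∞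
      (fun x ↦ TotalSpace.mk' (E →L[ℝ] E →L[ℝ] ℝ)
        (E := fun x ↦ (TangentSpace 𝓘(ℝ, E) x →L[ℝ] TangentSpace 𝓘(ℝ, E) x →L[ℝ] ℝ))
        x ((θ x).smulRight (θ x))) := by
  intro x₀
  have h := (contMDiffAt_hom_bundle _).1 (hθ x₀)
  refine (contMDiffAt_hom_bundle _).2 ⟨h.1, ?_⟩
  have h2 := h.2
  -- In a trivialization the tensor square is a fixed continuous bilinear map evaluated twice on the
  -- coordinates of `θ`.
  have h3 := (((ContinuousLinearMap.smulRightL ℝ E (E →L[ℝ] ℝ)).contMDiff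
    (n := ∞)).contMDiffAt.comp x₀ h2).clm_apply h2
  refine h3.congr_of_eventuallyEq ?_
  filter_upwards [(trivializationAt E (TangentSpace 𝓘(ℝ, E)) x₀).open_baseSet.mem_nhds
    (FiberBundle.mem_baseSet_trivializationAt' x₀)] with x hx
  ext v w
  rw [inCoordinates_apply_eq₂ hx hx (by simp)]
  have h4 (v : E) : ContinuousLinearMap.inCoordinates E (TangentSpace 𝓘(ℝ, E)) ℝ
      (fun b : M ↦ ℝ) x₀ x x₀ x (θ x) v =
    θ x ((trivializationAt E (TangentSpace 𝓘(ℝ, E)) x₀).symm x v) := by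
    rw [ContinuousLinearMap.inCoordinates_eq hx (by simp)]
    simp
  simp [h4]


end Smooth

variable {ι : Type*} [Fintype ι] [DecidableEq ι]
  {E : Type*} [NormedAddCommGroup E] [NormedSpace ℝ E] [FiniteDimensional ℝ E]
  {G : Type*} [TopologicalSpace G] [ChartedSpace E G] [Group G] [LieGroup 𝓘(ℝ, E) ∞ G]

omit [FiniteDimensional ℝ E] in
theorem mfderiv_mul_left_mulInvariantVectorField (p x : G) (v : GroupLieAlgebra 𝓘(ℝ, E) G) :
    mfderiv 𝓘(ℝ, E) 𝓘(ℝ, E) (fun y ↦ p * y) x (mulInvariantVectorField v x) =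
      mulInvariantVectorField v (p * x) := by
  have hd (p x : G) : MDifferentiableAt 𝓘(ℝ, E) 𝓘(ℝ, E) (fun y ↦ p * y) x :=
    (contMDiff_mul_left (I := 𝓘(ℝ, E)) (n := ∞)).contMDiffAt.mdifferentiableAt (by simp)
  have hcomp : (fun y ↦ p * x * y) = (fun y ↦ p * y) ∘ (fun y ↦ x * y) := by
    ext y
    simp [mul_assoc]
  have h1 : mfderiv 𝓘(ℝ, E) 𝓘(ℝ, E) (fun y ↦ p * x * y) 1 =
      (mfderiv 𝓘(ℝ, E) 𝓘(ℝ, E) (fun y ↦ p * y) (x * 1)).comp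
        (mfderiv 𝓘(ℝ, E) 𝓘(ℝ, E) (fun y ↦ x * y) 1) := by
    rw [hcomp]
    exact mfderiv_comp (I' := 𝓘(ℝ, E)) 1 (hd _ _) (hd _ _)
  have h2 : ∀ z, z = x → ∀ a : E,
      (mfderiv 𝓘(ℝ, E) 𝓘(ℝ, E) (fun y ↦ p * y) z : E →L[ℝ] E) a =
      (mfderiv 𝓘(ℝ, E) 𝓘(ℝ, E) (fun y ↦ p * y) x : E →L[ℝ] E) a := by
    rintro _ rfl a
    rfl
  exact (h2 _ (mul_one x) _).symm.trans (DFunLike.congr_fun h1 v).symm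

omit [FiniteDimensional ℝ E] in
theorem exists_mulInvariantVectorField_eq (x : G) (v : TangentSpace 𝓘(ℝ, E) x) :
    ∃ u : GroupLieAlgebra 𝓘(ℝ, E) G, mulInvariantVectorField u x = v :=
  (isInvertible_mfderiv_mul_left (E := E) x 1).surjective v

omit [FiniteDimensional ℝ E] in
/-- A left-invariant metric is determined by its metric Lie algebra. -/
theorem SmoothMetric.IsLeftInvariant.eq_of_lieInner_eq {g g' : SmoothMetric E G}
    (hg : g.IsLeftInvariant) (hg' : g'.IsLeftInvariant)
    (h : ∀ v w, g.lieInner v w = g'.lieInner v w) : g = g' := by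
  have hinner : g.inner = g'.inner := by
    funext x
    refine ContinuousLinearMap.ext fun v ↦ ContinuousLinearMap.ext fun w ↦ ?_
    obtain ⟨v, rfl⟩ := exists_mulInvariantVectorField_eq x v
    obtain ⟨w, rfl⟩ := exists_mulInvariantVectorField_eq x w
    rw [hg.inner_mulInvariantVectorField, hg'.inner_mulInvariantVectorField, h]
  cases g
  cases g'
  cases hinner
  rfl

omit [FiniteDimensional ℝ E] in
theorem SmoothMetric.linearIndependent_of_orthonormal {g : SmoothMetric E G}
    {e : ι → GroupLieAlgebra 𝓘(ℝ, E) G}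
    (he : ∀ i j, g.lieInner (e i) (e j) = if i = j then 1 else 0) : LinearIndependent ℝ e := by
  rw [Fintype.linearIndependent_iff]
  intro u hu i
  have h : g.lieInner (∑ j, u j • e j) (∑ j, (Pi.single i 1 : ι → ℝ) j • e j) = 0 := by
    rw [hu]
    exact DFunLike.congr_fun (map_zero (g.inner 1)) _
  rw [g.lieInner_sum_sum] at h
  simpa [he, Pi.single_apply] using h

/-- The coframe dual to the left-invariant extension of an orthonormal frame. -/
def SmoothMetric.coframe (g : SmoothMetric E G) (e : GroupLieAlgebra 𝓘(ℝ, E) G) (x : G) :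
    TangentSpace 𝓘(ℝ, E) x →L[ℝ] ℝ :=
  g.inner x (mulInvariantVectorField e x)

theorem SmoothMetric.IsLeftInvariant.sum_coframe {g : SmoothMetric E G} (hg : g.IsLeftInvariant)
    {e : ι → GroupLieAlgebra 𝓘(ℝ, E) G} (hcard : Fintype.card ι = Module.finrank ℝ E)
    (he : ∀ i j, g.lieInner (e i) (e j) = if i = j then 1 else 0) (x : G)
    (v : TangentSpace 𝓘(ℝ, E) x) :
    ∑ i, g.coframe (e i) x v • (mulInvariantVectorField (e i) x : TangentSpace 𝓘(ℝ, E) x) = v := by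
  let X : ι → E := fun i ↦ mulInvariantVectorField (I := 𝓘(ℝ, E)) (e i) x
  have hX : LinearIndependent ℝ X :=
    linearIndependent_mulInvariantVectorField (g.linearIndependent_of_orthonormal he) x
  let B := basisOfLinearIndependentOfCardEqFinrank' X hX hcard
  have hB (i : ι) : B i = X i := by simp [B]
  let θ : ι → E →L[ℝ] ℝ := fun i ↦ g.coframe (e i) x
  have hθ (i j : ι) : θ i (X j) = if i = j then 1 else 0 :=
    (hg.inner_mulInvariantVectorField (e i) (e j) x).trans (he i j)
  change ∑ i, θ i v • X i = (v : E)
  have hv (i : ι) : θ i v = B.repr v i := by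
    conv_lhs => rw [← B.sum_repr v]
    simp [hB, hθ]
  simp only [hv, ← hB]
  exact B.sum_repr v

end DiagonalMetric

/-! ### Left-invariant metrics diagonal in a given orthonormal frame. -/

section DiagonalMetric

open VectorField Bundle

variable {ι : Type*} [Fintype ι] [DecidableEq ι]
  {E : Type*} [NormedAddCommGroup E] [NormedSpace ℝ E] [FiniteDimensional ℝ E]
  {G : Type*} [TopologicalSpace G] [ChartedSpace E G] [Group G] [LieGroup 𝓘(ℝ, E) ∞ G]

/-- The bilinear form `∑ i, w i • θ i ⊗ θ i`, for `θ` the coframe of the left-invariant frame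
extending `e`. -/
def SmoothMetric.diagonalForm (g : SmoothMetric E G) (e : ι → GroupLieAlgebra 𝓘(ℝ, E) G)
    (w : ι → ℝ) (x : G) : TangentSpace 𝓘(ℝ, E) x →L[ℝ] TangentSpace 𝓘(ℝ, E) x →L[ℝ] ℝ :=
  ∑ i, w i • (g.coframe (e i) x).smulRight (g.coframe (e i) x)

omit [DecidableEq ι] [FiniteDimensional ℝ E] in
theorem SmoothMetric.diagonalForm_apply (g : SmoothMetric E G)
    (e : ι → GroupLieAlgebra 𝓘(ℝ, E) G) (w : ι → ℝ) (x : G) (u v : TangentSpace 𝓘(ℝ, E) x) :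
    g.diagonalForm e w x u v = ∑ i, w i * (g.coframe (e i) x u * g.coframe (e i) x v) := by
  simp [diagonalForm]

theorem SmoothMetric.IsLeftInvariant.inner_self_eq_sum {g : SmoothMetric E G}
    (hg : g.IsLeftInvariant) {e : ι → GroupLieAlgebra 𝓘(ℝ, E) G}
    (hcard : Fintype.card ι = Module.finrank ℝ E)
    (he : ∀ i j, g.lieInner (e i) (e j) = if i = j then 1 else 0) (x : G)
    (v : TangentSpace 𝓘(ℝ, E) x) : g.inner x v v = ∑ i, g.coframe (e i) x v ^ 2 := by
  let b : E →L[ℝ] E →L[ℝ] ℝ := g.inner x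
  let B : E →L[ℝ] ℝ := b.flip v
  let X : ι → E := fun i ↦ mulInvariantVectorField (I := 𝓘(ℝ, E)) (e i) x
  have h : B (∑ i, g.coframe (e i) x v • X i) = B v := congrArg B (hg.sum_coframe hcard he x v)
  rw [map_sum] at h
  refine h.symm.trans (Finset.sum_congr rfl fun i _ ↦ ?_)
  rw [map_smul, smul_eq_mul, sq]
  rfl

/-- The left-invariant metric in which the `g`-orthonormal frame `e` of the Lie algebra is
orthogonal with squared lengths `w`. -/
def SmoothMetric.IsLeftInvariant.diagonalMetric {g : SmoothMetric E G}
    (hg : g.IsLeftInvariant) {e : ι → GroupLieAlgebra 𝓘(ℝ, E) G}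
    (hcard : Fintype.card ι = Module.finrank ℝ E)
    (he : ∀ i j, g.lieInner (e i) (e j) = if i = j then 1 else 0) (w : ι → ℝ)
    (hw : ∀ i, 0 < w i) : SmoothMetric E G where
  inner := g.diagonalForm e w
  symm x u v := by
    simp only [g.diagonalForm_apply]
    exact Finset.sum_congr rfl fun i _ ↦ by ring
  pos x v hv := by
    have h := g.pos x v hv
    rw [hg.inner_self_eq_sum hcard he] at h
    obtain ⟨i, -, hi⟩ := Finset.exists_ne_zero_of_sum_ne_zero h.ne'
    rw [g.diagonalForm_apply]
    refine Finset.sum_pos' (fun j _ ↦ mul_nonneg (hw j).le (mul_self_nonneg _))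
      ⟨i, Finset.mem_univ i, mul_pos (hw i) ?_⟩
    exact mul_self_pos.2 fun h0 ↦ hi (by rw [h0]; norm_num)
  isVonNBounded x := by
    -- With `m ^ 2` a lower bound for the weights, the unit ball of the new metric lies in `m⁻¹`
    -- times that of `g`, which is bounded.
    obtain ⟨m, hm, hmw⟩ : ∃ m : ℝ, 0 < m ∧ ∀ i, m ^ 2 ≤ w i := by
      rcases isEmpty_or_nonempty ι with h | h
      · exact ⟨1, one_pos, fun i ↦ isEmptyElim i⟩
      · obtain ⟨i₀, hi₀⟩ := Finite.exists_min w
        refine ⟨Real.sqrt (w i₀), Real.sqrt_pos.2 (hw i₀), fun i ↦ ?_⟩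
        rw [Real.sq_sqrt (hw i₀).le]
        exact hi₀ i
    have hb := (g.isVonNBounded x).image
      (m⁻¹ • ContinuousLinearMap.id ℝ (TangentSpace 𝓘(ℝ, E) x))
    refine hb.subset ?_
    intro v hv
    refine (mem_image _ _ _).2 ⟨m • v, ?_, ?_⟩
    · rw [mem_ofPred_eq, g.diagonalForm_apply] at hv
      rw [mem_ofPred_eq, hg.inner_self_eq_sum hcard he]
      refine lt_of_le_of_lt (Finset.sum_le_sum fun i _ ↦ ?_) hv
      rw [map_smul, smul_eq_mul, mul_pow, ← sq]
      exact mul_le_mul_of_nonneg_right (hmw i) (sq_nonneg _)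
    · simp [smul_smul, hm.ne']
  contMDiff := by
    unfold SmoothMetric.diagonalForm
    refine ContMDiff.sum_section fun i _ ↦ ContMDiff.const_smul_section ?_
    exact contMDiff_smulRight_oneForm
      (g.contMDiff_contract (contMDiff_infty_mulInvariantVectorField (e i)))

variable {g : SmoothMetric E G} (hg : g.IsLeftInvariant) {e : ι → GroupLieAlgebra 𝓘(ℝ, E) G}
  (hcard : Fintype.card ι = Module.finrank ℝ E)
  (he : ∀ i j, g.lieInner (e i) (e j) = if i = j then 1 else 0) (w : ι → ℝ) (hw : ∀ i, 0 < w i)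

theorem SmoothMetric.IsLeftInvariant.diagonalMetric_inner (x : G)
    (u v : TangentSpace 𝓘(ℝ, E) x) : (hg.diagonalMetric hcard he w hw).inner x u v =
      ∑ i, w i * (g.coframe (e i) x u * g.coframe (e i) x v) :=
  g.diagonalForm_apply e w x u v

omit [Fintype ι] [DecidableEq ι] [FiniteDimensional ℝ E] in
theorem SmoothMetric.IsLeftInvariant.coframe_mulInvariantVectorField
    (hg : g.IsLeftInvariant) (x : G)
    (a b : GroupLieAlgebra 𝓘(ℝ, E) G) :
    g.coframe a x (mulInvariantVectorField b x) = g.lieInner a b :=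
  hg.inner_mulInvariantVectorField a b x

theorem SmoothMetric.IsLeftInvariant.diagonalMetric_isLeftInvariant :
    (hg.diagonalMetric hcard he w hw).IsLeftInvariant := by
  intro p x u v
  obtain ⟨u, rfl⟩ := exists_mulInvariantVectorField_eq x u
  obtain ⟨v, rfl⟩ := exists_mulInvariantVectorField_eq x v
  rw [mfderiv_mul_left_mulInvariantVectorField, mfderiv_mul_left_mulInvariantVectorField,
    hg.diagonalMetric_inner, hg.diagonalMetric_inner]
  simp only [hg.coframe_mulInvariantVectorField]

theorem SmoothMetric.IsLeftInvariant.diagonalMetric_lieInner (i j : ι) :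
    (hg.diagonalMetric hcard he w hw).lieInner (e i) (e j) = if i = j then w i else 0 := by
  rw [← (hg.diagonalMetric_isLeftInvariant hcard he w hw).inner_mulInvariantVectorField _ _ 1,
    hg.diagonalMetric_inner]
  simp only [hg.coframe_mulInvariantVectorField, he]
  simp only [mul_ite, mul_one, mul_zero, Finset.sum_ite_eq', Finset.mem_univ, if_true]
  split_ifs with h₁ h₂ h₂ <;> simp_all

/-- The coordinate expression of the Ricci tensor, as a bilinear form. -/
def CoordMetric.ricciForm (b : E → E →L[ℝ] E →L[ℝ] ℝ) (y : E) : E →ₗ[ℝ] E →ₗ[ℝ] ℝ :=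
  LinearMap.mk₂ ℝ (CoordMetric.ricci b y)
    (fun v v' w ↦ by
      simp only [CoordMetric.ricci, ← map_add]
      congr 1
      ext u
      simp [CoordMetric.curvature]
      abel)
    (fun r v w ↦ by
      simp only [CoordMetric.ricci, ← map_smul]
      congr 1
      ext u
      simp [CoordMetric.curvature, smul_sub, smul_add])
    (fun v w w' ↦ by
      simp only [CoordMetric.ricci, ← map_add]
      congr 1
      ext u
      simp [CoordMetric.curvature]
      abel)
    (fun r v w ↦ by
      simp only [CoordMetric.ricci, ← map_smul]
      congr 1
      ext u
      simp [CoordMetric.curvature, smul_sub, smul_add])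

/-- The Ricci tensor of a left-invariant metric `g'` in terms of a `g`-orthonormal frame. -/
theorem SmoothMetric.IsLeftInvariant.ricci_eq_sum {g' : SmoothMetric E G}
    (hg' : g'.IsLeftInvariant) {c : ι → ι → ι → ℝ} (hg : g.IsLeftInvariant)
    (hcard : Fintype.card ι = Module.finrank ℝ E)
    (he : ∀ i j, g.lieInner (e i) (e j) = if i = j then 1 else 0)
    (hc : ∀ i j, ⁅e i, e j⁆ = ∑ k, c i j k • e k) (x : G) (u v : TangentSpace 𝓘(ℝ, E) x) :
    g'.ricci x u v = ∑ i, ∑ j, g.coframe (e i) x u * g.coframe (e j) x v *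
      frameRicci c (Matrix.of fun i j ↦ g'.lieInner (e i) (e j)) i j := by
  let X : ι → E := fun i ↦ mulInvariantVectorField (I := 𝓘(ℝ, E)) (e i) x
  let R : E →ₗ[ℝ] E →ₗ[ℝ] ℝ :=
    CoordMetric.ricciForm (g'.inChart x) (extChartAt 𝓘(ℝ, E) x x)
  have hR (i j : ι) : R (X i) (X j) =
      frameRicci c (Matrix.of fun i j ↦ g'.lieInner (e i) (e j)) i j :=
    hg'.ricci_mulInvariantVectorField (g.linearIndependent_of_orthonormal he) hcard hc x i j
  have hu : ∑ i, g.coframe (e i) x u • X i = (u : E) := hg.sum_coframe hcard he x u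
  have hv : ∑ i, g.coframe (e i) x v • X i = (v : E) := hg.sum_coframe hcard he x v
  have h : R (∑ i, g.coframe (e i) x u • X i) (∑ i, g.coframe (e i) x v • X i) =
      R u v := by rw [hu, hv]
  refine h.symm.trans ?_
  simp only [map_sum, map_smul, LinearMap.sum_apply, LinearMap.smul_apply, smul_eq_mul,
    Finset.mul_sum, hR]
  rw [Finset.sum_comm]
  exact Finset.sum_congr rfl fun i _ ↦ Finset.sum_congr rfl fun j _ ↦ by ring

end DiagonalMetric

/-! ### Equivariance of the Ricci tensor under sign changes, and its value for diagonal brackets. -/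

section FrameRicci

variable {ι : Type*} [Fintype ι] [DecidableEq ι]

/-- Conjugating the metric by an automorphism with diagonal matrix `s`, `s i = ±1`. -/
theorem frameConn_conj {c : ι → ι → ι → ℝ} {s : ι → ℝ} (hs : ∀ i, s i * s i = 1)
    (hc : ∀ i j k, s i * s j * s k * c i j k = c i j k) (q : Matrix ι ι ℝ) (i j k : ι) :
    frameConn c (diagonal s * q * diagonal s) i j k = s i * s j * s k * frameConn c q i j k := by
  have hss : diagonal s * diagonal s = 1 := by
    rw [diagonal_mul_diagonal, ← diagonal_one]
    congr 1
    exact funext hs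
  have hsi : (diagonal s)⁻¹ = diagonal s := inv_eq_left_inv hss
  have hinv : (diagonal s * q * diagonal s)⁻¹ = diagonal s * q⁻¹ * diagonal s := by
    rw [Matrix.mul_inv_rev, Matrix.mul_inv_rev, hsi, Matrix.mul_assoc]
  have hc' (i j k : ι) : c i j k * s k = s i * s j * c i j k := by
    conv_lhs => rw [← hc i j k]
    linear_combination (s i * s j * c i j k) * hs k
  simp only [frameConn, hinv, mul_diagonal, diagonal_mul, Finset.mul_sum, Finset.sum_mul]
  refine Finset.sum_congr rfl fun m _ ↦ Finset.sum_congr rfl fun l _ ↦ ?_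
  linear_combination (1 / 2 : ℝ) * s m * s k * q⁻¹ m k *
      (q l m * s m * hc' i j l - q l i * s i * hc' j m l + q l j * s j * hc' m i l) +
    (1 / 2 : ℝ) * s i * s j * s k * q⁻¹ m k *
      (c i j l * q l m - c j m l * q l i + c m i l * q l j) * hs m

/-- Connection and structure constants both pick up one sign per index. Summed indices occur twice,
so their signs square to one and only those of `j` and `k` remain. -/
theorem frameRicci_conj {c : ι → ι → ι → ℝ} {s : ι → ℝ} (hs : ∀ i, s i * s i = 1)
    (hc : ∀ i j k, s i * s j * s k * c i j k = c i j k) (q : Matrix ι ι ℝ) (j k : ι) :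
    frameRicci c (diagonal s * q * diagonal s) j k = s j * s k * frameRicci c q j k := by
  simp only [frameRicci, frameCurvature, frameConn_conj hs hc, Finset.mul_sum]
  refine Finset.sum_congr rfl fun i _ ↦ Finset.sum_congr rfl fun l _ ↦ ?_
  have hil : c i j l = s i * s j * s l * c i j l := (hc i j l).symm
  generalize frameConn c q = w
  linear_combination (s j * s k * (w j k l * w i l i - w i k l * w j l i)
    - s k * w l k i * s j * c i j l) * ((s l * s l) * hs i + hs l)
    - s k * w l k i * s l * s i * hil

end FrameRicci

/-- Structure constants of a diagonal bracket on a three-dimensional Lie algebra. -/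
def milnorConst (l : Fin 3 → ℝ) (i j k : Fin 3) : ℝ :=
  if j = i + 1 ∧ k = i + 2 then l k else if j = i + 2 ∧ k = i + 1 then -l k else 0

theorem frameConn_milnor (l q : Fin 3 → ℝ) (hq : ∀ i, q i ≠ 0) (i j k : Fin 3) :
    frameConn (milnorConst l) (diagonal q) i j k =
      (milnorConst l i j k * q k - milnorConst l j k i * q i + milnorConst l k i j * q j)
        / (2 * q k) := by
  have hinv : (diagonal q)⁻¹ = diagonal fun i ↦ (q i)⁻¹ := by
    refine inv_eq_left_inv ?_
    rw [diagonal_mul_diagonal, ← diagonal_one]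
    congr 1
    exact funext fun i ↦ inv_mul_cancel₀ (hq i)
  have hk := hq k
  simp only [frameConn, hinv, diagonal_apply, mul_ite, mul_zero, Finset.sum_sub_distrib,
    Finset.sum_add_distrib, Finset.sum_ite_eq', Finset.mem_univ, if_true]
  field_simp

/-- Milnor's formula. Vanishing off the diagonal is what allows a flow of diagonal metrics to be
constructed. -/
theorem frameRicci_milnor (l q : Fin 3 → ℝ) (hq : ∀ i, q i ≠ 0) (i j : Fin 3) :
    frameRicci (milnorConst l) (diagonal q) i j =
      if i = j then (l i ^ 2 * q i ^ 2 - (l (i + 1) * q (i + 1) - l (i + 2) * q (i + 2)) ^ 2)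
        / (2 * (q (i + 1) * q (i + 2))) else 0 := by
  have h0 := hq 0
  have h1 := hq 1
  have h2 := hq 2
  simp only [frameRicci, frameCurvature, frameConn_milnor l q hq, Fin.sum_univ_three]
  fin_cases i <;> fin_cases j <;> simp [milnorConst] <;> field_simp <;> ring

/-! ### Uniqueness for autonomous equations on arbitrary intervals. -/

section ODE

variable {V : Type*} [NormedAddCommGroup V] [NormedSpace ℝ V]

/-- Two solutions on an interval of an autonomous differential equation whose right-hand side is
`C¹` near the solutions agree if they agree at one time. -/
theorem eqOn_of_hasDerivWithinAt_of_contDiffAt {F : V → V} {J : Set ℝ} (hJ : J.OrdConnected)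
    {t₀ : ℝ} (ht₀ : t₀ ∈ J) {p q : ℝ → V} (hp : ∀ t ∈ J, HasDerivWithinAt p (F (p t)) J t)
    (hq : ∀ t ∈ J, HasDerivWithinAt q (F (q t)) J t) (hFp : ∀ t ∈ J, ContDiffAt ℝ 1 F (p t))
    (hFq : ∀ t ∈ J, ContDiffAt ℝ 1 F (q t)) (h₀ : p t₀ = q t₀) : EqOn p q J := by
  have hpc : ContinuousOn p J := fun t ht ↦ (hp t ht).continuousWithinAt
  have hqc : ContinuousOn q J := fun t ht ↦ (hq t ht).continuousWithinAt
  -- The right-hand side is only locally Lipschitz; over a compact time interval both trajectories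
  -- form a compact set, on which one constant suffices.
  have hlip : ∀ I ⊆ J, IsCompact I → ∃ K, LipschitzOnWith K F (p '' I ∪ q '' I) := by
    intro I hI hIc
    refine LocallyLipschitzOn.exists_lipschitzOnWith_of_compact
      ((hIc.image_of_continuousOn (hpc.mono hI)).union
        (hIc.image_of_continuousOn (hqc.mono hI))) ?_
    rintro x (⟨t, ht, rfl⟩ | ⟨t, ht, rfl⟩)
    · obtain ⟨K, U, hU, hK⟩ := (hFp t (hI ht)).exists_lipschitzOnWith
      exact ⟨K, U, mem_nhdsWithin_of_mem_nhds hU, hK⟩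
    · obtain ⟨K, U, hU, hK⟩ := (hFq t (hI ht)).exists_lipschitzOnWith
      exact ⟨K, U, mem_nhdsWithin_of_mem_nhds hU, hK⟩
  intro t ht
  rcases le_total t₀ t with h | h
  · have hI : Icc t₀ t ⊆ J := hJ.out ht₀ ht
    obtain ⟨K, hK⟩ := hlip _ hI isCompact_Icc
    have hd {r : ℝ → V} (hr : ∀ t ∈ J, HasDerivWithinAt r (F (r t)) J t) :
        ∀ u ∈ Ico t₀ t, HasDerivWithinAt r (F (r u)) (Ici u) u := fun u hu ↦
      (hr u (hI ⟨hu.1, hu.2.le⟩)).mono_of_mem_nhdsWithin (mem_of_superset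
        (Icc_mem_nhdsGE hu.2) ((Icc_subset_Icc_left hu.1).trans hI))
    exact ODE_solution_unique_of_mem_Icc_right (v := fun _ ↦ F)
      (s := fun _ ↦ p '' Icc t₀ t ∪ q '' Icc t₀ t) (fun _ _ ↦ hK) (hpc.mono hI) (hd hp)
      (fun u hu ↦ .inl ⟨u, ⟨hu.1, hu.2.le⟩, rfl⟩) (hqc.mono hI) (hd hq)
      (fun u hu ↦ .inr ⟨u, ⟨hu.1, hu.2.le⟩, rfl⟩) h₀ ⟨h, le_rfl⟩
  · have hI : Icc t t₀ ⊆ J := hJ.out ht ht₀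
    obtain ⟨K, hK⟩ := hlip _ hI isCompact_Icc
    have hd {r : ℝ → V} (hr : ∀ t ∈ J, HasDerivWithinAt r (F (r t)) J t) :
        ∀ u ∈ Ioc t t₀, HasDerivWithinAt r (F (r u)) (Iic u) u := fun u hu ↦
      (hr u (hI ⟨hu.1.le, hu.2⟩)).mono_of_mem_nhdsWithin (mem_of_superset
        (Icc_mem_nhdsLE hu.1) ((Icc_subset_Icc_right hu.2).trans hI))
    exact ODE_solution_unique_of_mem_Icc_left (v := fun _ ↦ F)
      (s := fun _ ↦ p '' Icc t t₀ ∪ q '' Icc t t₀) (fun _ _ ↦ hK) (hpc.mono hI) (hd hp)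
      (fun u hu ↦ .inl ⟨u, ⟨hu.1.le, hu.2⟩, rfl⟩) (hqc.mono hI) (hd hq)
      (fun u hu ↦ .inr ⟨u, ⟨hu.1.le, hu.2⟩, rfl⟩) h₀ ⟨le_rfl, h⟩

end ODE

/-! ### Smooth dependence of the Ricci tensor on the Gram matrix. -/

section Smooth

variable {ι : Type*} [Fintype ι] [DecidableEq ι]

theorem ContDiffAt.matrix_det {D : Type*} [NormedAddCommGroup D] [NormedSpace ℝ D]
    {n : WithTop ℕ∞} {M : D → Matrix ι ι ℝ} {x : D}
    (hM : ∀ i j, ContDiffAt ℝ n (fun y ↦ M y i j) x) : ContDiffAt ℝ n (fun y ↦ (M y).det) x := by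
  simp only [Matrix.det_apply']
  exact ContDiffAt.sum fun σ _ ↦ contDiffAt_const.mul (contDiffAt_prod fun i _ ↦ hM _ _)

/-- Cramer's rule: entries of the inverse are minors divided by the determinant. -/
theorem ContDiffAt.matrix_inv {D : Type*} [NormedAddCommGroup D] [NormedSpace ℝ D]
    {n : WithTop ℕ∞} {M : D → Matrix ι ι ℝ} {x : D}
    (hM : ∀ i j, ContDiffAt ℝ n (fun y ↦ M y i j) x) (h : (M x).det ≠ 0) (i j : ι) :
    ContDiffAt ℝ n (fun y ↦ (M y)⁻¹ i j) x := by
  simp only [Matrix.inv_def, Matrix.smul_apply, smul_eq_mul, Ring.inverse_eq_inv',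
    Matrix.adjugate_apply]
  refine ((ContDiffAt.matrix_det hM).inv h).mul (ContDiffAt.matrix_det fun k l ↦ ?_)
  simp only [Matrix.updateRow_apply]
  split_ifs
  · exact contDiffAt_const
  · exact hM k l

theorem contDiffAt_frameRicci {c : ι → ι → ι → ℝ} {n : WithTop ℕ∞} {q : ι → ι → ℝ}
    (hq : (Matrix.of q).det ≠ 0) (i j : ι) :
    ContDiffAt ℝ n (fun q : ι → ι → ℝ ↦ frameRicci c (Matrix.of q) i j) q := by
  have hM (i j : ι) : ContDiffAt ℝ n (fun q : ι → ι → ℝ ↦ (Matrix.of q) i j) q := by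
    simp only [Matrix.of_apply]
    fun_prop
  have hω (i j k : ι) : ContDiffAt ℝ n
      (fun q : ι → ι → ℝ ↦ frameConn c (Matrix.of q) i j k) q := by
    unfold frameConn
    refine ContDiffAt.sum fun m _ ↦ ContDiffAt.mul (contDiffAt_const.mul
      (ContDiffAt.sum fun l _ ↦ ?_)) (ContDiffAt.matrix_inv hM hq m k)
    exact ((contDiffAt_const.mul (hM _ _)).sub (contDiffAt_const.mul (hM _ _))).add
      (contDiffAt_const.mul (hM _ _))
  unfold frameRicci frameCurvature
  exact ContDiffAt.sum fun m _ ↦ ContDiffAt.sum fun l _ ↦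
    (((hω _ _ _).mul (hω _ _ _)).sub ((hω _ _ _).mul (hω _ _ _))).sub
      (contDiffAt_const.mul (hω _ _ _))

end Smooth

/-! ### Diagonalizing a unimodular bracket in dimension three. -/

section MilnorFrame

/-- The cross product of two vectors of an orthonormal triple. -/
theorem orthogonal_cross {U : Matrix (Fin 3) (Fin 3) ℝ} (hU : U * Uᵀ = 1) :
    ∃ d : ℝ, ∀ m, U 1 (m + 1) * U 2 (m + 2) - U 1 (m + 2) * U 2 (m + 1) = d * U 0 m ∧
      U 2 (m + 1) * U 0 (m + 2) - U 2 (m + 2) * U 0 (m + 1) = d * U 1 m ∧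
      U 0 (m + 1) * U 1 (m + 2) - U 0 (m + 2) * U 1 (m + 1) = d * U 2 m := by
  have hU' : Uᵀ * U = 1 := mul_eq_one_comm.1 hU
  have h (n m : Fin 3) : U 0 n * U 0 m + U 1 n * U 1 m + U 2 n * U 2 m = if n = m then 1 else 0 := by
    have := congrFun (congrFun hU' n) m
    simpa [Matrix.mul_apply, Fin.sum_univ_three, Matrix.one_apply] using this
  -- Since `U⁻¹ = Uᵀ`, the cofactors of `U` are `det U` times its entries.
  refine ⟨U.det, fun m ↦ ?_⟩
  have h0 := h 0 m
  have h1 := h 1 m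
  have h2 := h 2 m
  rw [det_fin_three]
  refine ⟨?_, ?_, ?_⟩
  · fin_cases m <;> simp at h0 h1 h2 ⊢ <;>
      linear_combination -(U 1 1 * U 2 2 - U 1 2 * U 2 1) * h0
        - (U 1 2 * U 2 0 - U 1 0 * U 2 2) * h1 - (U 1 0 * U 2 1 - U 1 1 * U 2 0) * h2
  · fin_cases m <;> simp at h0 h1 h2 ⊢ <;>
      linear_combination -(U 2 1 * U 0 2 - U 2 2 * U 0 1) * h0
        - (U 2 2 * U 0 0 - U 2 0 * U 0 2) * h1 - (U 2 0 * U 0 1 - U 2 1 * U 0 0) * h2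
  · fin_cases m <;> simp at h0 h1 h2 ⊢ <;>
      linear_combination -(U 0 1 * U 1 2 - U 0 2 * U 1 1) * h0
        - (U 0 2 * U 1 0 - U 0 0 * U 1 2) * h1 - (U 0 0 * U 1 1 - U 0 1 * U 1 0) * h2

theorem exists_orthonormal_frame {L : Type*} [AddCommGroup L] [Module ℝ L]
    (hL : Module.finrank ℝ L = 3) (B : LinearMap.BilinForm ℝ L) (hB : ∀ v w, B v w = B w v)
    (hpos : ∀ v, v ≠ 0 → 0 < B v v) :
    ∃ e : Module.Basis (Fin 3) ℝ L, ∀ i j, B (e i) (e j) = if i = j then 1 else 0 := by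
  have : FiniteDimensional ℝ L := Module.finite_of_finrank_pos (by rw [hL]; norm_num)
  obtain ⟨v, hv⟩ := LinearMap.BilinForm.exists_orthogonal_basis (B := B) ⟨hB⟩
  let b := v.reindex (finCongr hL)
  have hb (i j : Fin 3) (hij : i ≠ j) : B (b i) (b j) = 0 := by
    have := hv (fun h ↦ hij ((finCongr hL).symm.injective h) :
      (finCongr hL).symm i ≠ (finCongr hL).symm j)
    simpa [b] using this
  have hbp (i : Fin 3) : 0 < B (b i) (b i) := hpos _ (b.ne_zero i)
  let r (i : Fin 3) : ℝ := (Real.sqrt (B (b i) (b i)))⁻¹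
  have hr (i : Fin 3) : r i * r i * B (b i) (b i) = 1 := by
    have := Real.sq_sqrt (hbp i).le
    have h0 := (Real.sqrt_pos.2 (hbp i)).ne'
    simp only [r]
    field_simp
    exact this.symm
  have hr0 (i : Fin 3) : IsUnit (r i) :=
    isUnit_iff_ne_zero.2 (inv_ne_zero (Real.sqrt_pos.2 (hbp i)).ne')
  refine ⟨b.isUnitSMul hr0, fun i j ↦ ?_⟩
  simp only [Module.Basis.isUnitSMul_apply, map_smul, LinearMap.smul_apply, smul_eq_mul]
  split_ifs with h
  · subst h
    rw [← mul_assoc, hr]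
  · rw [hb i j h, mul_zero, mul_zero]

/-- A unimodular three-dimensional Lie algebra with an inner product has an orthonormal basis
diagonalizing the bracket. -/
theorem exists_isMilnorFrame {L : Type*} [LieRing L] [LieAlgebra ℝ L]
    (hL : Module.finrank ℝ L = 3) (hu : LieIsUnimodular L) (B : LinearMap.BilinForm ℝ L)
    (hB : ∀ v w, B v w = B w v) (hpos : ∀ v, v ≠ 0 → 0 < B v v) :
    ∃ (f : Fin 3 → L) (l : Fin 3 → ℝ), IsMilnorFrame (fun v w ↦ B v w) f l := by
  obtain ⟨e, he⟩ := exists_orthonormal_frame hL B hB hpos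
  let A : Matrix (Fin 3) (Fin 3) ℝ := Matrix.of fun k i ↦ e.repr ⁅e (i + 1), e (i + 2)⁆ k
  have hA (i : Fin 3) : ⁅e (i + 1), e (i + 2)⁆ = ∑ k, A k i • e k := (e.sum_repr _).symm
  -- The trace of `ad (e i)` is exactly the difference of these two entries of `A`, so unimodularity
  -- is symmetry of `A`.
  have htr (i : Fin 3) : A (i + 1) (i + 2) = A (i + 2) (i + 1) := by
    have := hu (e i)
    rw [LinearMap.trace_eq_matrix_trace ℝ e, Matrix.trace, Fin.sum_univ_three] at this
    simp only [Matrix.diag_apply, LinearMap.toMatrix_apply, LieAlgebra.ad_apply] at this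
    have hskew (i j k : Fin 3) : e.repr ⁅e i, e j⁆ k = -e.repr ⁅e j, e i⁆ k := by
      rw [← lie_skew, map_neg, Finsupp.neg_apply]
    fin_cases i <;> simp [A] at this ⊢
    · linarith [hskew 0 2 2]
    · linarith [hskew 1 0 0]
    · linarith [hskew 2 1 1]
  have hAs : A.IsHermitian := by
    ext i j
    have h0 := htr 0
    have h1 := htr 1
    have h2 := htr 2
    fin_cases i <;> fin_cases j <;> simp_all
  let u := hAs.eigenvectorBasis
  let U : Matrix (Fin 3) (Fin 3) ℝ := Matrix.of fun i k ↦ u i k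
  have hU : U * Uᵀ = 1 := by
    ext i j
    have := orthonormal_iff_ite.1 u.orthonormal j i
    simpa [Matrix.mul_apply, U, PiLp.inner_apply, Matrix.one_apply, eq_comm] using this
  have hUA (i n : Fin 3) : ∑ m, A n m * U i m = hAs.eigenvalues i * U i n := by
    have := congrFun (hAs.mulVec_eigenvectorBasis i) n
    simpa [Matrix.mulVec, dotProduct, U] using this
  obtain ⟨d, hd⟩ := orthogonal_cross hU
  -- The bracket depends on two vectors only through the coordinates of their cross product.
  have hbr (i j : Fin 3) : ⁅∑ k, U i k • e k, ∑ k, U j k • e k⁆ =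
      ∑ m, (U i (m + 1) * U j (m + 2) - U i (m + 2) * U j (m + 1)) • ⁅e (m + 1), e (m + 2)⁆ := by
    simp only [Fin.sum_univ_three, lie_add, add_lie, smul_lie, lie_smul, lie_self, smul_zero]
    change _ = (U i 1 * U j 2 - U i 2 * U j 1) • ⁅e 1, e 2⁆ +
      (U i 2 * U j 0 - U i 0 * U j 2) • ⁅e 2, e 0⁆ + (U i 0 * U j 1 - U i 1 * U j 0) • ⁅e 0, e 1⁆
    rw [← lie_skew (e 1) (e 0), ← lie_skew (e 2) (e 1), ← lie_skew (e 0) (e 2)]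
    module
  have hbr' (i j k : Fin 3)
      (h : ∀ m, U i (m + 1) * U j (m + 2) - U i (m + 2) * U j (m + 1) = d * U k m) :
      ⁅∑ k, U i k • e k, ∑ k, U j k • e k⁆ = (d * hAs.eigenvalues k) • ∑ m, U k m • e m := by
    rw [hbr]
    simp only [h, hA, Finset.smul_sum, smul_smul]
    rw [Finset.sum_comm]
    refine Finset.sum_congr rfl fun n _ ↦ ?_
    rw [← Finset.sum_smul, mul_assoc, ← hUA, Finset.mul_sum]
    congr 1
    exact Finset.sum_congr rfl fun m _ ↦ by ring
  -- The factor `d` carries the orientation of the eigenbasis, so no choice of orientation is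
  -- needed.
  refine ⟨fun i ↦ ∑ k, U i k • e k, fun i ↦ d * hAs.eigenvalues i, fun i j ↦ ?_,
    hbr' 1 2 0 fun m ↦ (hd m).1, hbr' 2 0 1 fun m ↦ (hd m).2.1, hbr' 0 1 2 fun m ↦ (hd m).2.2⟩
  have := congrFun (congrFun hU i) j
  simpa [he, Matrix.mul_apply, Matrix.one_apply, mul_comm] using this

end MilnorFrame

/-! ### From squared lengths to structure constants and their ratios. -/

section Evolution

theorem IsMilnorFrame.lie_eq {L : Type*} [LieRing L] [LieAlgebra ℝ L] {Q : L → L → ℝ}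
    {f : Fin 3 → L} {l : Fin 3 → ℝ} (h : IsMilnorFrame Q f l) (i j : Fin 3) :
    ⁅f i, f j⁆ = ∑ k, milnorConst l i j k • f k := by
  have h0 := h.bracket_one_two
  have h1 := h.bracket_two_zero
  have h2 := h.bracket_zero_one
  have h0' : ⁅f 2, f 1⁆ = -(l 0 • f 0) := by rw [← h0, lie_skew]
  have h1' : ⁅f 0, f 2⁆ = -(l 1 • f 1) := by rw [← h1, lie_skew]
  have h2' : ⁅f 1, f 0⁆ = -(l 2 • f 2) := by rw [← h2, lie_skew]
  rw [Fin.sum_univ_three]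
  fin_cases i <;> fin_cases j <;> simp [milnorConst, h0, h1, h2, h0', h1', h2']

/-- The evolution equation of a structure constant along the Ricci flow. -/
theorem hasDerivWithinAt_structureConst {x y z : ℝ → ℝ} {J : Set ℝ} {t L M N : ℝ}
    (hx : 0 < x t) (hy : 0 < y t) (hz : 0 < z t)
    (hx' : HasDerivWithinAt x
      (-((L ^ 2 * x t ^ 2 - (M * y t - N * z t) ^ 2) / (y t * z t))) J t)
    (hy' : HasDerivWithinAt y
      (-((M ^ 2 * y t ^ 2 - (N * z t - L * x t) ^ 2) / (z t * x t))) J t)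
    (hz' : HasDerivWithinAt z
      (-((N ^ 2 * z t ^ 2 - (L * x t - M * y t) ^ 2) / (x t * y t))) J t)
    {a b c : ℝ} (ha : a = L * √(x t) / (√(y t) * √(z t)))
    (hb : b = M * √(y t) / (√(z t) * √(x t))) (hc : c = N * √(z t) / (√(x t) * √(y t))) :
    HasDerivWithinAt (fun s ↦ L * √(x s) / (√(y s) * √(z s)))
      (a / 2 * ((b - c) ^ 2 - 3 * a ^ 2 + 2 * a * (b + c))) J t := by
  have h := ((hx'.sqrt hx.ne').const_mul L).div ((hy'.sqrt hy.ne').mul (hz'.sqrt hz.ne'))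
    (mul_pos (Real.sqrt_pos.2 hy) (Real.sqrt_pos.2 hz)).ne'
  refine h.congr_deriv ?_
  rw [Pi.mul_apply]
  have hxs := Real.sq_sqrt hx.le
  have hys := Real.sq_sqrt hy.le
  have hzs := Real.sq_sqrt hz.le
  have hx0 := Real.sqrt_pos.2 hx
  have hy0 := Real.sqrt_pos.2 hy
  have hz0 := Real.sqrt_pos.2 hz
  -- In terms of the square roots the claim is an identity of rational functions.
  generalize √(x t) = X at *
  generalize √(y t) = Y at *
  generalize √(z t) = Z at *
  rw [ha, hb, hc, ← hxs, ← hys, ← hzs]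
  field_simp
  ring

/-- The system is homogeneous of degree three, so the derivative of a ratio is `a ^ 2` times a
function of ratios. Of the third structure constant only the value `c` at time `t` enters. -/
theorem hasDerivWithinAt_ratio {a b : ℝ → ℝ} {J : Set ℝ} {t c : ℝ} (ha0 : a t ≠ 0)
    (ha : HasDerivWithinAt a
      (a t / 2 * ((b t - c) ^ 2 - 3 * a t ^ 2 + 2 * a t * (b t + c))) J t)
    (hb : HasDerivWithinAt b
      (b t / 2 * ((c - a t) ^ 2 - 3 * b t ^ 2 + 2 * b t * (c + a t))) J t) :
    HasDerivWithinAt (fun s ↦ b s / a s)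
      (2 * a t ^ 2 * (b t / a t) * (1 - b t / a t) * (1 + b t / a t - c / a t)) J t := by
  refine (hb.div ha ha0).congr_deriv ?_
  field_simp
  ring

/-- The structure constants of the frame obtained from an orthogonal frame with structure constants
`l` and squared lengths `q` by rescaling to unit length. -/
def rescaledConst (l q : Fin 3 → ℝ) (i : Fin 3) : ℝ :=
  l i * √(q i) / (√(q (i + 1)) * √(q (i + 2)))

theorem hasDerivWithinAt_rescaledConst {q : ℝ → Fin 3 → ℝ} {l : Fin 3 → ℝ} {J : Set ℝ} {t : ℝ}
    (hpos : ∀ i, 0 < q t i)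
    (hq : ∀ i, HasDerivWithinAt (fun s ↦ q s i) (-((l i ^ 2 * q t i ^ 2
      - (l (i + 1) * q t (i + 1) - l (i + 2) * q t (i + 2)) ^ 2)
        / (q t (i + 1) * q t (i + 2)))) J t) (i : Fin 3) :
    HasDerivWithinAt (fun s ↦ rescaledConst l (q s) i)
      (rescaledConst l (q t) i / 2 *
        ((rescaledConst l (q t) (i + 1) - rescaledConst l (q t) (i + 2)) ^ 2
          - 3 * rescaledConst l (q t) i ^ 2 + 2 * rescaledConst l (q t) i *
            (rescaledConst l (q t) (i + 1) + rescaledConst l (q t) (i + 2)))) J t := by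
  have h1 : i + 1 + 1 = i + 2 := by grind
  have h2 : i + 1 + 2 = i := by grind
  have h3 : i + 2 + 1 = i := by grind
  have h4 : i + 2 + 2 = i + 1 := by grind
  have hd0 := hq i
  have hd1 := hq (i + 1)
  have hd2 := hq (i + 2)
  have ha : rescaledConst l (q t) i = l i * √(q t i) / (√(q t (i + 1)) * √(q t (i + 2))) := rfl
  have hb : rescaledConst l (q t) (i + 1) =
      l (i + 1) * √(q t (i + 1)) / (√(q t (i + 2)) * √(q t i)) := by
    rw [rescaledConst, h1, h2]
  have hc : rescaledConst l (q t) (i + 2) =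
      l (i + 2) * √(q t (i + 2)) / (√(q t i) * √(q t (i + 1))) := by
    rw [rescaledConst, h3, h4]
  rw [h1, h2] at hd1
  rw [h3, h4] at hd2
  have h := hasDerivWithinAt_structureConst (x := fun s ↦ q s i) (y := fun s ↦ q s (i + 1))
    (z := fun s ↦ q s (i + 2)) (L := l i) (M := l (i + 1)) (N := l (i + 2))
    (hpos i) (hpos (i + 1)) (hpos (i + 2)) hd0 hd1 hd2 ha hb hc
  exact h

theorem hasDerivWithinAt_ratios {a : ℝ → Fin 3 → ℝ} {J : Set ℝ} {t : ℝ} (ha0 : a t 0 ≠ 0)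
    (ha : ∀ i, HasDerivWithinAt (fun s ↦ a s i)
      (a t i / 2 * ((a t (i + 1) - a t (i + 2)) ^ 2 - 3 * a t i ^ 2
        + 2 * a t i * (a t (i + 1) + a t (i + 2)))) J t) :
    HasDerivWithinAt (fun s ↦ a s 1 / a s 0)
      (2 * a t 0 ^ 2 * (a t 1 / a t 0) * (1 - a t 1 / a t 0)
        * (1 + a t 1 / a t 0 - a t 2 / a t 0)) J t ∧
    HasDerivWithinAt (fun s ↦ a s 2 / a s 0)
      (2 * a t 0 ^ 2 * (a t 2 / a t 0) * (1 - a t 2 / a t 0)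
        * (1 - a t 1 / a t 0 + a t 2 / a t 0)) J t := by
  have hd0 := ha 0
  have hd1 := ha 1
  have hd2 := ha 2
  rw [show (0 + 1 : Fin 3) = 1 from rfl, show (0 + 2 : Fin 3) = 2 from rfl] at hd0
  rw [show (1 + 1 : Fin 3) = 2 from rfl, show (1 + 2 : Fin 3) = 0 from rfl] at hd1
  rw [show (2 + 1 : Fin 3) = 0 from rfl, show (2 + 2 : Fin 3) = 1 from rfl] at hd2
  refine ⟨hasDerivWithinAt_ratio (a := fun s ↦ a s 0) (b := fun s ↦ a s 1) ha0 hd0 hd1,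
    -- The system is symmetric in the last two indices, so the same computation applies with their
    -- roles exchanged.
    (hasDerivWithinAt_ratio (a := fun s ↦ a s 0) (b := fun s ↦ a s 2) (c := a t 1) ha0
      (hd0.congr_deriv ?_) (hd2.congr_deriv ?_)).congr_deriv ?_⟩
  all_goals ring

end Evolution

/-! ### Uniqueness, preservation of diagonality, and existence of the flow. -/

section Flow

variable {ι : Type*} [Fintype ι] [DecidableEq ι]
  {E : Type*} [NormedAddCommGroup E] [NormedSpace ℝ E] [FiniteDimensional ℝ E]
  {G : Type*} [TopologicalSpace G] [ChartedSpace E G] [Group G] [LieGroup 𝓘(ℝ, E) ∞ G]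

omit [FiniteDimensional ℝ E] [LieGroup 𝓘(ℝ, E) ∞ G] in
theorem mulInvariantVectorField_one (v : GroupLieAlgebra 𝓘(ℝ, E) G) :
    mulInvariantVectorField v (1 : G) = v := by
  have h : (fun y : G ↦ 1 * y) = id := by
    ext y
    simp
  have h1 : mfderiv 𝓘(ℝ, E) 𝓘(ℝ, E) (fun y : G ↦ 1 * y) 1 =
      mfderiv 𝓘(ℝ, E) 𝓘(ℝ, E) (id : G → G) 1 := by rw [h]
  have h2 : (mfderiv 𝓘(ℝ, E) 𝓘(ℝ, E) (fun y : G ↦ 1 * y) 1 : E →L[ℝ] E) =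
    ContinuousLinearMap.id ℝ E := h1.trans mfderiv_id
  exact DFunLike.congr_fun h2 v

omit [DecidableEq ι] in
/-- Left-invariant metrics that agree on a frame of the Lie algebra are equal. -/
theorem SmoothMetric.IsLeftInvariant.eq_of_frame {g g' : SmoothMetric E G}
    (hg : g.IsLeftInvariant) (hg' : g'.IsLeftInvariant) {e : ι → GroupLieAlgebra 𝓘(ℝ, E) G}
    (he : LinearIndependent ℝ e) (hcard : Fintype.card ι = Module.finrank ℝ E)
    (h : ∀ i j, g.lieInner (e i) (e j) = g'.lieInner (e i) (e j)) : g = g' := by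
  refine hg.eq_of_lieInner_eq hg' fun v w ↦ ?_
  have hspan (v : GroupLieAlgebra 𝓘(ℝ, E) G) : ∃ u : ι → ℝ, ∑ i, u i • e i = v := by
    let X : ι → E := e
    have hX : LinearIndependent ℝ X := he
    let B := basisOfLinearIndependentOfCardEqFinrank' X hX hcard
    refine ⟨B.repr v, ?_⟩
    have := B.sum_repr v
    simpa [B] using! this
  obtain ⟨u, rfl⟩ := hspan v
  obtain ⟨u', rfl⟩ := hspan w
  simp only [SmoothMetric.lieInner_sum_sum, h]

/-- The Ricci flow of left-invariant metrics as an ordinary differential equation for the Gram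
matrix of a frame. -/
theorem IsLeftInvariantRicciFlow.hasDerivWithinAt_gram {g₀ : SmoothMetric E G}
    {g : ℝ → SmoothMetric E G} {J : Set ℝ} (h : IsLeftInvariantRicciFlow g₀ g J)
    {e : ι → GroupLieAlgebra 𝓘(ℝ, E) G} (he : LinearIndependent ℝ e)
    (hcard : Fintype.card ι = Module.finrank ℝ E) {c : ι → ι → ι → ℝ}
    (hc : ∀ i j, ⁅e i, e j⁆ = ∑ k, c i j k • e k) {t : ℝ} (ht : t ∈ J) (i j : ι) :
    HasDerivWithinAt (fun s ↦ (g s).lieInner (e i) (e j))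
      (-2 * frameRicci c (Matrix.of fun i j ↦ (g t).lieInner (e i) (e j)) i j) J t := by
  rw [← (h.leftInvariant t ht).ricci_mulInvariantVectorField he hcard hc 1 i j,
    mulInvariantVectorField_one, mulInvariantVectorField_one]
  exact h.ricciFlow t ht 1 (e i) (e j)

theorem contDiffAt_ricciFlow {c : ι → ι → ι → ℝ} {q : ι → ι → ℝ}
    (hq : (Matrix.of q).det ≠ 0) :
    ContDiffAt ℝ 1 (fun (q : ι → ι → ℝ) i j ↦ -2 * frameRicci c (Matrix.of q) i j) q :=
  contDiffAt_pi.2 fun i ↦ contDiffAt_pi.2 fun j ↦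
    contDiffAt_const.mul (contDiffAt_frameRicci hq i j)

/-- Uniqueness of the Ricci flow of left-invariant metrics. -/
theorem IsLeftInvariantRicciFlow.eqOn {g₀ : SmoothMetric E G} {g g' : ℝ → SmoothMetric E G}
    {J : Set ℝ} (hJ : J.OrdConnected) (h0 : 0 ∈ J) (h : IsLeftInvariantRicciFlow g₀ g J)
    (h' : IsLeftInvariantRicciFlow g₀ g' J) {e : ι → GroupLieAlgebra 𝓘(ℝ, E) G}
    (he : LinearIndependent ℝ e) (hcard : Fintype.card ι = Module.finrank ℝ E)
    {c : ι → ι → ι → ℝ} (hc : ∀ i j, ⁅e i, e j⁆ = ∑ k, c i j k • e k) : EqOn g g' J := by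
  have key : EqOn (fun t i j ↦ (g t).lieInner (e i) (e j))
      (fun t i j ↦ (g' t).lieInner (e i) (e j)) J := by
    refine eqOn_of_hasDerivWithinAt_of_contDiffAt
      (F := fun (q : ι → ι → ℝ) i j ↦ -2 * frameRicci c (Matrix.of q) i j) hJ h0 ?_ ?_ ?_ ?_ ?_
    · exact fun t ht ↦ hasDerivWithinAt_pi.2 fun i ↦ hasDerivWithinAt_pi.2 fun j ↦
        h.hasDerivWithinAt_gram he hcard hc ht i j
    · exact fun t ht ↦ hasDerivWithinAt_pi.2 fun i ↦ hasDerivWithinAt_pi.2 fun j ↦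
        h'.hasDerivWithinAt_gram he hcard hc ht i j
    · exact fun t _ ↦ contDiffAt_ricciFlow ((g t).isUnit_det_gram he).ne_zero
    · exact fun t _ ↦ contDiffAt_ricciFlow ((g' t).isUnit_det_gram he).ne_zero
    · simp only [h.initial, h'.initial]
  exact fun t ht ↦ (h.leftInvariant t ht).eq_of_frame (h'.leftInvariant t ht) he hcard
    fun i j ↦ congrFun (congrFun (key ht) i) j

variable {g₀ : SmoothMetric E G} {f : Fin 3 → GroupLieAlgebra 𝓘(ℝ, E) G} {l : Fin 3 → ℝ}

/-- A Milnor frame of the initial metric stays orthogonal along the Ricci flow. -/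
theorem IsLeftInvariantRicciFlow.lieInner_eq_zero (hE : Module.finrank ℝ E = 3)
    (hf : IsMilnorFrame g₀.lieInner f l) {g : ℝ → SmoothMetric E G} {J : Set ℝ}
    (hJ : J.OrdConnected) (h0 : 0 ∈ J) (h : IsLeftInvariantRicciFlow g₀ g J) {t : ℝ}
    (ht : t ∈ J) {i j : Fin 3} (hij : i ≠ j) : (g t).lieInner (f i) (f j) = 0 := by
  have he := SmoothMetric.linearIndependent_of_orthonormal hf.orthonormal
  have hcard : Fintype.card (Fin 3) = Module.finrank ℝ E := by rw [hE, Fintype.card_fin]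
  have hc := hf.lie_eq
  -- The automorphism fixing `f i` and reversing the two other vectors. As `j ≠ i`, it flips the
  -- sign of the entry `(i, j)`.
  let s : Fin 3 → ℝ := fun k ↦ if k = i then 1 else -1
  have hs (k : Fin 3) : s k * s k = 1 := by
    simp only [s]
    split_ifs <;> norm_num
  -- A nonzero constant has three distinct indices, exactly two of which carry a minus sign.
  have hsc (a b d : Fin 3) : s a * s b * s d * milnorConst l a b d = milnorConst l a b d := by
    fin_cases i <;> fin_cases a <;> fin_cases b <;> fin_cases d <;> simp [s, milnorConst]
  have hconj (q : Fin 3 → Fin 3 → ℝ) : (Matrix.of fun a b ↦ s a * s b * q a b) =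
      diagonal s * Matrix.of q * diagonal s := by
    ext a b
    simp only [mul_diagonal, diagonal_mul, Matrix.of_apply]
    ring
  -- The conjugated Gram matrices solve the same equation and also start at the identity, so they
  -- equal the original ones.
  have key : EqOn (fun t a b ↦ (g t).lieInner (f a) (f b))
      (fun t a b ↦ s a * s b * (g t).lieInner (f a) (f b)) J := by
    refine eqOn_of_hasDerivWithinAt_of_contDiffAt
      (F := fun (q : Fin 3 → Fin 3 → ℝ) i j ↦ -2 * frameRicci (milnorConst l) (Matrix.of q) i j)
      hJ h0 ?_ ?_ ?_ ?_ ?_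
    · exact fun t ht ↦ hasDerivWithinAt_pi.2 fun a ↦ hasDerivWithinAt_pi.2 fun b ↦
        h.hasDerivWithinAt_gram he hcard hc ht a b
    · refine fun t ht ↦ hasDerivWithinAt_pi.2 fun a ↦ hasDerivWithinAt_pi.2 fun b ↦ ?_
      refine ((h.hasDerivWithinAt_gram he hcard hc ht a b).const_mul (s a * s b)).congr_deriv ?_
      rw [hconj fun a b ↦ (g t).lieInner (f a) (f b), frameRicci_conj hs hsc]
      ring
    · exact fun t _ ↦ contDiffAt_ricciFlow ((g t).isUnit_det_gram he).ne_zero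
    · refine fun t _ ↦ contDiffAt_ricciFlow ?_
      rw [hconj fun a b ↦ (g t).lieInner (f a) (f b), det_mul, det_mul]
      have hs0 : (diagonal s).det ≠ 0 := by
        rw [det_diagonal]
        exact Finset.prod_ne_zero_iff.2 fun k _ hk ↦ by simpa [hk] using hs k
      exact mul_ne_zero (mul_ne_zero hs0 ((g t).isUnit_det_gram he).ne_zero) hs0
    · funext a b
      simp only [h.initial, hf.orthonormal]
      split_ifs with hab
      · rw [hab, hs, one_mul]
      · rw [mul_zero]
  have h1 := congrFun (congrFun (key ht) i) j
  simp only [s, if_true, if_neg hij.symm] at h1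
  linarith

/-- The evolution of the squared lengths of a Milnor frame. -/
theorem IsLeftInvariantRicciFlow.hasDerivWithinAt_lieInner_self (hE : Module.finrank ℝ E = 3)
    (hf : IsMilnorFrame g₀.lieInner f l) {g : ℝ → SmoothMetric E G} {J : Set ℝ}
    (hJ : J.OrdConnected) (h0 : 0 ∈ J) (h : IsLeftInvariantRicciFlow g₀ g J) {t : ℝ}
    (ht : t ∈ J) (i : Fin 3) : HasDerivWithinAt (fun s ↦ (g s).lieInner (f i) (f i))
      (-((l i ^ 2 * (g t).lieInner (f i) (f i) ^ 2
          - (l (i + 1) * (g t).lieInner (f (i + 1)) (f (i + 1))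
            - l (i + 2) * (g t).lieInner (f (i + 2)) (f (i + 2))) ^ 2)
        / ((g t).lieInner (f (i + 1)) (f (i + 1)) * (g t).lieInner (f (i + 2)) (f (i + 2)))))
      J t := by
  have he := SmoothMetric.linearIndependent_of_orthonormal hf.orthonormal
  have hcard : Fintype.card (Fin 3) = Module.finrank ℝ E := by rw [hE, Fintype.card_fin]
  have hpos (i : Fin 3) : 0 < (g t).lieInner (f i) (f i) := (g t).pos 1 _ (he.ne_zero i)
  have hdiag : (Matrix.of fun i j ↦ (g t).lieInner (f i) (f j)) =
      diagonal fun i ↦ (g t).lieInner (f i) (f i) := by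
    ext a b
    rw [Matrix.of_apply, diagonal_apply]
    split_ifs with hab
    · rw [hab]
    · exact h.lieInner_eq_zero hE hf hJ h0 ht hab
  refine (h.hasDerivWithinAt_gram he hcard hf.lie_eq ht i i).congr_deriv ?_
  rw [hdiag, frameRicci_milnor _ _ fun i ↦ (hpos i).ne', if_pos rfl]
  have h1 := (hpos (i + 1)).ne'
  have h2 := (hpos (i + 2)).ne'
  field_simp

/-- Short-time existence of the Ricci flow of left-invariant metrics. -/
theorem exists_isLeftInvariantRicciFlow (hE : Module.finrank ℝ E = 3)
    (hg₀ : g₀.IsLeftInvariant) (hf : IsMilnorFrame g₀.lieInner f l) :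
    ∃ ε : ℝ, 0 < ε ∧ ∃ g : ℝ → SmoothMetric E G,
      IsLeftInvariantRicciFlow g₀ g (Ioo (-ε) ε) := by
  have hcard : Fintype.card (Fin 3) = Module.finrank ℝ E := by rw [hE, Fintype.card_fin]
  let V : (Fin 3 → ℝ) → Fin 3 → ℝ := fun q i ↦
    -((l i ^ 2 * q i ^ 2 - (l (i + 1) * q (i + 1) - l (i + 2) * q (i + 2)) ^ 2)
      / (q (i + 1) * q (i + 2)))
  -- The initial value is `1` in every slot because the frame is orthonormal for `g₀`.
  have hV : ContDiffAt ℝ 1 V 1 := by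
    refine contDiffAt_pi.2 fun i ↦ ?_
    simp only [V]
    have hp (i : Fin 3) : ContDiffAt ℝ 1 (fun q : Fin 3 → ℝ ↦ q i) 1 := by fun_prop
    exact (((contDiffAt_const.mul ((hp _).pow 2)).sub
      (((contDiffAt_const.mul (hp _)).sub (contDiffAt_const.mul (hp _))).pow 2)).div
        ((hp _).mul (hp _)) (by simp)).neg
  obtain ⟨q, hq0, ε, hε, hq⟩ :=
    hV.exists_forall_mem_closedBall_exists_eq_forall_mem_Ioo_hasDerivAt₀ 0
  rw [zero_sub, zero_add] at hq
  have hqpos : ∀ᶠ s in 𝓝 (0 : ℝ), ∀ i, 0 < q s i := by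
    rw [eventually_all]
    intro i
    have hcont : ContinuousAt (fun s ↦ q s i) 0 :=
      (continuous_apply i).continuousAt.comp (hq 0 ⟨by linarith, hε⟩).continuousAt
    exact hcont.eventually (lt_mem_nhds (by simp [hq0]))
  obtain ⟨δ, hδ, hqδ⟩ := Metric.eventually_nhds_iff.1 hqpos
  have hpos : ∀ s ∈ Ioo (-min ε δ) (min ε δ), ∀ i, 0 < q s i := fun s hs ↦ by
    refine hqδ ?_
    rw [Real.dist_eq, sub_zero, abs_lt]
    exact ⟨(neg_le_neg (min_le_right ε δ)).trans_lt hs.1, hs.2.trans_le (min_le_right ε δ)⟩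
  classical
  -- The default `g₀` is never used on the final interval, which was shrunk so that all `q s i` stay
  -- positive.
  let g : ℝ → SmoothMetric E G := fun s ↦
    if h : ∀ i, 0 < q s i then hg₀.diagonalMetric hcard hf.orthonormal (q s) h else g₀
  have hg (s : ℝ) (h : ∀ i, 0 < q s i) :
      g s = hg₀.diagonalMetric hcard hf.orthonormal (q s) h := dif_pos h
  refine ⟨min ε δ, lt_min hε hδ, g, ?_, ?_, ?_⟩
  · intro t ht x v w
    -- The coframe belongs to `g₀` and does not move, so only the coefficients are differentiated,
    -- at every point of the group at once.
    have hder : HasDerivWithinAt (fun s ↦ ∑ i, q s i *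
        (g₀.coframe (f i) x v * g₀.coframe (f i) x w))
        (∑ i, V (q t) i * (g₀.coframe (f i) x v * g₀.coframe (f i) x w))
        (Ioo (-min ε δ) (min ε δ)) t := by
      refine HasDerivWithinAt.fun_sum fun i _ ↦ HasDerivWithinAt.mul_const ?_ _
      refine HasDerivAt.hasDerivWithinAt (hasDerivAt_pi.1 (hq t ?_) i)
      exact ⟨(neg_le_neg (min_le_left ε δ)).trans_lt ht.1, ht.2.trans_le (min_le_left ε δ)⟩
    refine (hder.congr_deriv ?_).congr (fun s hs ↦ ?_) ?_
    · have hli : (g t).IsLeftInvariant := by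
        rw [hg t (hpos t ht)]
        exact hg₀.diagonalMetric_isLeftInvariant hcard hf.orthonormal _ _
      have hgram : (Matrix.of fun i j ↦ (g t).lieInner (f i) (f j)) = diagonal (q t) := by
        ext i j
        rw [hg t (hpos t ht), Matrix.of_apply, hg₀.diagonalMetric_lieInner, diagonal_apply]
      rw [hli.ricci_eq_sum hg₀ hcard hf.orthonormal hf.lie_eq, hgram, Finset.mul_sum]
      refine Finset.sum_congr rfl fun i _ ↦ ?_
      simp only [frameRicci_milnor _ _ fun i ↦ (hpos t ht i).ne', mul_ite, mul_zero,
        Finset.sum_ite_eq, Finset.mem_univ, if_true, V]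
      have h1 := (hpos t ht (i + 1)).ne'
      have h2 := (hpos t ht (i + 2)).ne'
      field_simp
    · rw [hg s (hpos s hs)]
      exact hg₀.diagonalMetric_inner hcard hf.orthonormal _ _ x v w
    · rw [hg t (hpos t ht)]
      exact hg₀.diagonalMetric_inner hcard hf.orthonormal _ _ x v w
  · intro t ht
    rw [hg t (hpos t ht)]
    exact hg₀.diagonalMetric_isLeftInvariant hcard hf.orthonormal _ _
  · have h0 : ∀ i, 0 < q 0 i := fun i ↦ by simp [hq0]
    rw [hg 0 h0]
    refine (hg₀.diagonalMetric_isLeftInvariant hcard hf.orthonormal _ _).eq_of_frame hg₀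
      (SmoothMetric.linearIndependent_of_orthonormal hf.orthonormal) hcard fun i j ↦ ?_
    rw [hg₀.diagonalMetric_lieInner, hf.orthonormal, hq0]
    rfl

/-- Rescaling an orthogonal frame with diagonal bracket to unit length. -/
theorem IsMilnorFrame.rescale {L : Type*} [LieRing L] [LieAlgebra ℝ L]
    {Q₀ : L → L → ℝ} {f : Fin 3 → L} {l : Fin 3 → ℝ} (hf : IsMilnorFrame Q₀ f l)
    (B : LinearMap.BilinForm ℝ L) (hB : ∀ i j, i ≠ j → B (f i) (f j) = 0)
    (hpos : ∀ i, 0 < B (f i) (f i)) :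
    IsMilnorFrame (fun v w ↦ B v w) (fun i ↦ (√(B (f i) (f i)))⁻¹ • f i)
      (rescaledConst l fun i ↦ B (f i) (f i)) := by
  have hs (i : Fin 3) : √(B (f i) (f i)) ≠ 0 := (Real.sqrt_pos.2 (hpos i)).ne'
  have hsq (i : Fin 3) := Real.sq_sqrt (hpos i).le
  refine ⟨fun i j ↦ ?_, ?_, ?_, ?_⟩
  · simp only [map_smul, LinearMap.smul_apply, smul_eq_mul]
    split_ifs with h
    · subst h
      have h1 := hs i
      have h2 := hsq i
      field_simp
      exact h2.symm
    · rw [hB i j h, mul_zero, mul_zero]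
  · rw [smul_lie, lie_smul, hf.bracket_one_two]
    simp only [smul_smul]
    congr 1
    have h0 := hs 0
    have h1 := hs 1
    have h2 := hs 2
    simp only [rescaledConst, zero_add]
    field_simp
  · rw [smul_lie, lie_smul, hf.bracket_two_zero]
    simp only [smul_smul]
    congr 1
    have h0 := hs 0
    have h1 := hs 1
    have h2 := hs 2
    simp only [rescaledConst, show (1 + 1 : Fin 3) = 2 from rfl, show (1 + 2 : Fin 3) = 0 from rfl]
    field_simp
  · rw [smul_lie, lie_smul, hf.bracket_zero_one]
    simp only [smul_smul]
    congr 1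
    have h0 := hs 0
    have h1 := hs 1
    have h2 := hs 2
    simp only [rescaledConst, show (2 + 1 : Fin 3) = 0 from rfl, show (2 + 2 : Fin 3) = 1 from rfl]
    field_simp

/-- The metric Lie algebra as a bilinear form. -/
def SmoothMetric.lieForm (g : SmoothMetric E G) :
    LinearMap.BilinForm ℝ (GroupLieAlgebra 𝓘(ℝ, E) G) :=
  LinearMap.mk₂ ℝ g.lieInner
    (fun u v w ↦ DFunLike.congr_fun (map_add (g.inner 1) u v) w)
    (fun c u w ↦ DFunLike.congr_fun (map_smul (g.inner 1) c u) w)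
    (fun u v w ↦ map_add (g.inner 1 u) v w)
    (fun c u w ↦ map_smul (g.inner 1 u) c w)

end Flow

end

theorem mainTheorem4
    {G : Type*} [TopologicalSpace G] [ChartedSpace (EuclideanSpace ℝ (Fin 3)) G] [Group G]
    [LieGroup (𝓡 3) ∞ G] [SimplyConnectedSpace G]
    (hunimodular : LieIsUnimodular (GroupLieAlgebra (𝓡 3) G))
    (hnonabelian : ¬ IsLieAbelian (GroupLieAlgebra (𝓡 3) G))
    (g₀ : SmoothMetric (EuclideanSpace ℝ (Fin 3)) G) (hg₀ : g₀.IsLeftInvariant) :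
    -- the Ricci flow with initial metric `g₀` exists as a flow of left-invariant metrics
    (∃ ε : ℝ, 0 < ε ∧ ∃ g : ℝ → SmoothMetric (EuclideanSpace ℝ (Fin 3)) G,
      IsLeftInvariantRicciFlow g₀ g (Ioo (-ε) ε)) ∧
    -- and as such it is unique on every interval
    (∀ J : Set ℝ, J.OrdConnected → 0 ∈ J →
      ∀ g g' : ℝ → SmoothMetric (EuclideanSpace ℝ (Fin 3)) G,
        IsLeftInvariantRicciFlow g₀ g J → IsLeftInvariantRicciFlow g₀ g' J →
          ∀ t ∈ J, g t = g' t) ∧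
    -- there is an orthonormal frame of the initial metric Lie algebra diagonalizing the bracket
    (∃ (f : Fin 3 → GroupLieAlgebra (𝓡 3) G) (l : Fin 3 → ℝ), IsMilnorFrame g₀.lieInner f l) ∧
    -- for each such frame `f`, rescaling its vectors to unit length realizes the Ricci flow
    -- as a flow of the structure constants
    (∀ (f : Fin 3 → GroupLieAlgebra (𝓡 3) G) (l : Fin 3 → ℝ), IsMilnorFrame g₀.lieInner f l →
      ∀ J : Set ℝ, J.OrdConnected → 0 ∈ J →
      ∀ g : ℝ → SmoothMetric (EuclideanSpace ℝ (Fin 3)) G, IsLeftInvariantRicciFlow g₀ g J →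
      ∃ a : ℝ → Fin 3 → ℝ,
        (∀ t ∈ J, IsMilnorFrame (g t).lieInner
          (fun i ↦ (Real.sqrt ((g t).lieInner (f i) (f i)))⁻¹ • f i) (a t)) ∧
        (∀ t ∈ J, ∀ i : Fin 3, HasDerivWithinAt (fun s ↦ a s i)
          (a t i / 2 * ((a t (i + 1) - a t (i + 2)) ^ 2 - 3 * a t i ^ 2
            + 2 * a t i * (a t (i + 1) + a t (i + 2)))) J t) ∧
        (l 0 ≠ 0 → ∀ t ∈ J, a t 0 ≠ 0 ∧
          HasDerivWithinAt (fun s ↦ a s 1 / a s 0)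
            (2 * a t 0 ^ 2 * (a t 1 / a t 0) * (1 - a t 1 / a t 0)
              * (1 + a t 1 / a t 0 - a t 2 / a t 0)) J t ∧
          HasDerivWithinAt (fun s ↦ a s 2 / a s 0)
            (2 * a t 0 ^ 2 * (a t 2 / a t 0) * (1 - a t 2 / a t 0)
              * (1 - a t 1 / a t 0 + a t 2 / a t 0)) J t)) := by

  have hE : Module.finrank ℝ (EuclideanSpace ℝ (Fin 3)) = 3 := finrank_euclideanSpace_fin
  have hcard : Fintype.card (Fin 3) = Module.finrank ℝ (EuclideanSpace ℝ (Fin 3)) := by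
    rw [hE, Fintype.card_fin]
  have hframe : ∃ (f : Fin 3 → GroupLieAlgebra (𝓡 3) G) (l : Fin 3 → ℝ),
      IsMilnorFrame g₀.lieInner f l :=
    exists_isMilnorFrame hE hunimodular g₀.lieForm g₀.lieInner_comm fun v hv ↦ g₀.pos 1 v hv
  refine ⟨?_, ?_, hframe, ?_⟩
  · obtain ⟨f, l, hf⟩ := hframe
    exact exists_isLeftInvariantRicciFlow hE hg₀ hf
  · obtain ⟨f, l, hf⟩ := hframe
    intro J hJ h0 g g' h h' t ht
    exact h.eqOn hJ h0 h' (SmoothMetric.linearIndependent_of_orthonormal hf.orthonormal) hcard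
      hf.lie_eq ht
  · intro f l hf J hJ h0 g h
    have hli := SmoothMetric.linearIndependent_of_orthonormal hf.orthonormal
    have hpos (t : ℝ) (i : Fin 3) : 0 < (g t).lieInner (f i) (f i) := (g t).pos 1 _ (hli.ne_zero i)
    let a : ℝ → Fin 3 → ℝ := fun t ↦ rescaledConst l fun i ↦ (g t).lieInner (f i) (f i)
    have ha : ∀ t ∈ J, ∀ i : Fin 3, HasDerivWithinAt (fun s ↦ a s i)
        (a t i / 2 * ((a t (i + 1) - a t (i + 2)) ^ 2 - 3 * a t i ^ 2
          + 2 * a t i * (a t (i + 1) + a t (i + 2)))) J t := fun t ht ↦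
      hasDerivWithinAt_rescaledConst (q := fun t i ↦ (g t).lieInner (f i) (f i)) (hpos t)
        (h.hasDerivWithinAt_lieInner_self hE hf hJ h0 ht)
    refine ⟨a, fun t ht ↦ hf.rescale (g t).lieForm
      (fun i j hij ↦ h.lieInner_eq_zero hE hf hJ h0 ht hij) (hpos t), ha, ?_⟩
    intro hl t ht
    -- `a t 0` is `l 0` times a positive factor, so it cannot vanish along the flow.
    have ha0 : a t 0 ≠ 0 := div_ne_zero (mul_ne_zero hl (Real.sqrt_pos.2 (hpos t 0)).ne')
      (mul_pos (Real.sqrt_pos.2 (hpos t _)) (Real.sqrt_pos.2 (hpos t _))).ne'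
    exact ⟨ha0, hasDerivWithinAt_ratios ha0 (ha t ht)⟩
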